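/- Let $n\ge 2$ and let $\Omega\subset\mathbb R^n$ be open. Let $\mathscr H^{n-1}$ be the $(n-1)$-dimensional Hausdorff (outer) measure on $\mathbb R^n$, normalized so that $\mathscr H^{n-1}$ is Lebesgue measure on $\mathbb R^{n-1}$; "$\mathscr H^{n-1}$-measurable" means measurable in the sense of Carathéodory. A set $E\subset\mathbb R^n$ is *$(n-1)$-rectifiable* if it is $\mathscr H^{n-1}$-measurable, $\mathscr H^{n-1}(E)<\infty$, and there are Lipschitz maps $f_k:\mathbb R^{n-1}\to\mathbb R^n$ ($k\in\mathbb N$) with $\mathscr H^{n-1}(E\setminus\bigcup_k f_k(\mathbb R^{n-1}))=0$. Write $\Theta^{n-1}(E,x)=\lim_{r\to0^+}\frac{\mathscr H^{n-1}(E\cap B(x,r))}{\alpha(n-1)r^{n-1}}$ when the limit exists, where $B(x,r)$ is the closed ball and $\alpha(n-1)$ is the volume of the unit ball of $\mathbb R^{n-1}$. For $S\subset\Omega$ let $$\mathscr I^{n-1}(S)=\sup\{\mathscr H^{n-1}(S\cap E): E\subset\Omega\ \text{is } (n-1)\text{-rectifiable}\},$$ which is a measure on the Borel $\sigma$-algebra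 $\mathscr B(\Omega)$. Let $\mathscr E$ be the collection of Borel $(n-1)$-rectifiable sets $E\subset\Omega$ such that, for every $x\in\Omega$, $x\in E$ if and only if $\Theta^{n-1}(E,x)=1$. For $x\in\Omega$, on $\mathscr E_x=\{E\in\mathscr E: x\in E\}$ consider the equivalence relation $E\sim_xE'$ if and only if $\Theta^{n-1}(E\ominus E',x)=0$, where $\ominus$ is the symmetric difference, and let $[E]_x$ be the class of $E$. Let $\hat\Omega$ be the set of all pairs $(x,[E]_x)$ with $x\in\Omega$ and $E\in\mathscr E_x$, let $p:\hat\Omega\to\Omega$, $p(x,[E]_x)=x$, and for $E\in\mathscr E$ let $\gamma_E:E\to\hat\Omega$, $\gamma_E(x)=(x,[E]_x)$. Let $\hat{\mathscr A}$ be the $\sigma$-algebra of all $A\subset\hat\Omega$ such that $\gamma_E^{-1}(A)$ is $\mathscr H^{n-1}$-measurable for every $E\in\mathscr E$, and let $\hat{\mathscr I}^{n-1}$ be the least upper bound, among measures on $(\hat\Omega,\hat{\mathscr A})$, of the measures $\mu_E(A)=\mathscr H^{n-1}(\gamma_E^{-1}(A))$, $E\in\mathscr E$. Then the map $\Upsilon: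 L^\infty(\hat\Omega,\hat{\mathscr A},\hat{\mathscr I}^{n-1})\to L^1(\Omega,\mathscr B(\Omega),\mathscr I^{n-1})^*$ (real-valued functions) given by $$\Upsilon(g)(f)=\int_{\hat\Omega} g\,(f\circ p)\,d\hat{\mathscr I}^{n-1}$$ is well defined (the integrand is integrable and the integral does not depend on the representatives chosen) and is a surjective linear isometry. -/

import Mathlib

open MeasureTheory Set Filter Topology
open scoped ENNReal symmDiff

noncomputable section

namespace RectGerm

/-- The Hausdorff measure `ℋ^{n-1}` of `ℝⁿ` as an outer measure on all subsets, normalized as in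
geometric measure theory (`ℋ^m` is Lebesgue measure on `ℝ^m`). -/
def hausdorffOuter (n : ℕ) : OuterMeasure (EuclideanSpace ℝ (Fin n)) :=
  (μHE[n - 1] : Measure (EuclideanSpace ℝ (Fin n))).toOuterMeasure

/-- Countably `(n-1)`-rectifiable sets: `ℋ^{n-1}`-almost all of the set is covered by countably
many Lipschitz images of `ℝ^{n-1}`. -/
def IsCountablyRectifiable {n : ℕ} (E : Set (EuclideanSpace ℝ (Fin n))) : Prop :=
  ∃ f : ℕ → EuclideanSpace ℝ (Fin (n - 1)) → EuclideanSpace ℝ (Fin n),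
    (∀ k, ∃ K, LipschitzWith K (f k)) ∧ hausdorffOuter n (E \ ⋃ k, range (f k)) = 0

/-- `(n-1)`-rectifiable sets: `ℋ^{n-1}`-measurable (in the sense of Carathéodory), of finite
`ℋ^{n-1}`-measure and countably `(n-1)`-rectifiable. -/
structure IsRectifiable {n : ℕ} (E : Set (EuclideanSpace ℝ (Fin n))) : Prop where
  isCaratheodory : (hausdorffOuter n).IsCaratheodory E
  lt_top : hausdorffOuter n E < ∞
  countablyRectifiable : IsCountablyRectifiable E

/-- The ratio `ℋ^{n-1}(E ∩ B(x,r)) / (α(n-1) r^{n-1})`, where `B(x,r)` is the closed ball and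
`α(n-1)` is the volume of the unit ball of `ℝ^{n-1}`. -/
def densityRatio {n : ℕ} (E : Set (EuclideanSpace ℝ (Fin n))) (x : EuclideanSpace ℝ (Fin n))
    (r : ℝ) : ℝ≥0∞ :=
  hausdorffOuter n (E ∩ Metric.closedBall x r) /
    (volume (Metric.closedBall (0 : EuclideanSpace ℝ (Fin (n - 1))) 1) *
      ENNReal.ofReal r ^ (n - 1))

/-- `Θ^{n-1}(E,x) = c`: the lower and upper `(n-1)`-dimensional densities of `E` at `x` (the
lower and upper limits of `densityRatio E x r` as `r → 0⁺`) both equal `c`. -/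
def HasDensity {n : ℕ} (E : Set (EuclideanSpace ℝ (Fin n))) (x : EuclideanSpace ℝ (Fin n))
    (c : ℝ≥0∞) : Prop :=
  Tendsto (densityRatio E x) (𝓝[>] 0) (𝓝 c)

/-- The collection `ℰ` of the Borel measurable `(n-1)`-rectifiable sets `E ⊆ Ω` such that a point
`x ∈ Ω` belongs to `E` if and only if `Θ^{n-1}(E,x) = 1`. -/
structure IsNormalized {n : ℕ} (Ω E : Set (EuclideanSpace ℝ (Fin n))) : Prop where
  subset : E ⊆ Ω
  measurableSet : MeasurableSet E
  rectifiable : IsRectifiable E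
  mem_iff : ∀ x ∈ Ω, x ∈ E ↔ HasDensity E x 1

/-- The collection `ℰ`, as a type. -/
abbrev Normalized {n : ℕ} (Ω : Set (EuclideanSpace ℝ (Fin n))) :=
  {E : Set (EuclideanSpace ℝ (Fin n)) // IsNormalized Ω E}

/-- The collection `ℰ_x` of the members of `ℰ` that contain `x`. -/
abbrev NormalizedAt {n : ℕ} (Ω : Set (EuclideanSpace ℝ (Fin n)))
    (x : EuclideanSpace ℝ (Fin n)) :=
  {E : Set (EuclideanSpace ℝ (Fin n)) // IsNormalized Ω E ∧ x ∈ E}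

theorem HasDensity.zero_of_subset_union {n : ℕ} {A B C : Set (EuclideanSpace ℝ (Fin n))}
    {x : EuclideanSpace ℝ (Fin n)} (hA : HasDensity A x 0) (hB : HasDensity B x 0)
    (h : C ⊆ A ∪ B) : HasDensity C x 0 := by
  have hAB : Tendsto (fun r => densityRatio A x r + densityRatio B x r) (𝓝[>] 0) (𝓝 0) := by
    simpa using Tendsto.add hA hB
  refine tendsto_of_tendsto_of_tendsto_of_le_of_le tendsto_const_nhds hAB
    (fun _ => zero_le) fun r => ?_
  simp only [densityRatio]
  rw [← ENNReal.add_div]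
  refine ENNReal.div_le_div_right ?_ _
  refine le_trans ((hausdorffOuter n).mono ?_) (measure_union_le _ _)
  rw [← union_inter_distrib_right]
  exact inter_subset_inter_left _ h

/-- The relation `∼_x` on `ℰ_x`: `E ∼_x E'` if and only if `Θ^{n-1}(E ⊖ E', x) = 0`. -/
def germSetoid {n : ℕ} (Ω : Set (EuclideanSpace ℝ (Fin n))) (x : EuclideanSpace ℝ (Fin n)) :
    Setoid (NormalizedAt Ω x) where
  r E E' := HasDensity (E.1 ∆ E'.1) x 0
  iseqv :=
    { refl := fun E => by
        simp only [symmDiff_self, HasDensity]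
        have : densityRatio (⊥ : Set (EuclideanSpace ℝ (Fin n))) x = fun _ => 0 := by
          funext r
          simp [densityRatio]
        rw [this]
        exact tendsto_const_nhds
      symm := fun {E E'} h => by rwa [symmDiff_comm]
      trans := fun {E E' E''} h h' => h.zero_of_subset_union h' (symmDiff_triangle _ _ _) }

/-- The approximate germs at `x`. -/
abbrev Germ {n : ℕ} (Ω : Set (EuclideanSpace ℝ (Fin n))) (x : EuclideanSpace ℝ (Fin n)) :=
  Quotient (germSetoid Ω x)

/-- The fiber space `Ω̂` of the pairs `(x, [E]_x)`, where `x ∈ Ω` and `[E]_x` is an approximate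
germ at `x`. -/
def FiberSpace {n : ℕ} (Ω : Set (EuclideanSpace ℝ (Fin n))) := Σ x : Ω, Germ Ω x.1

/-- The projection `p : Ω̂ → Ω`. -/
def proj {n : ℕ} {Ω : Set (EuclideanSpace ℝ (Fin n))} (z : FiberSpace Ω) : Ω := z.1

/-- The map `γ_E : E → Ω̂`, `x ↦ (x, [E]_x)`. -/
def germMap {n : ℕ} {Ω : Set (EuclideanSpace ℝ (Fin n))} (E : Normalized Ω) (x : E.1) :
    FiberSpace Ω :=
  ⟨⟨x.1, E.2.subset x.2⟩, Quotient.mk (germSetoid Ω x.1) ⟨E.1, E.2, x.2⟩⟩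

/-- `γ_E⁻¹(A)`, as a subset of `ℝⁿ`. -/
def germPreimage {n : ℕ} {Ω : Set (EuclideanSpace ℝ (Fin n))} (E : Normalized Ω)
    (A : Set (FiberSpace Ω)) : Set (EuclideanSpace ℝ (Fin n)) :=
  Subtype.val '' (germMap E ⁻¹' A)

/-- The σ-algebra of the sets `A ⊆ Ω̂` such that `γ_E⁻¹(A)` is `ℋ^{n-1}`-measurable for all
`E ∈ ℰ`. -/
instance fiberMeasurableSpace {n : ℕ} (Ω : Set (EuclideanSpace ℝ (Fin n))) :
    MeasurableSpace (FiberSpace Ω) where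
  MeasurableSet' A := ∀ E : Normalized Ω, (hausdorffOuter n).IsCaratheodory (germPreimage E A)
  measurableSet_empty E := by
    have h : germPreimage E ∅ = ∅ := by rw [germPreimage, preimage_empty, image_empty]
    rw [h]
    exact (hausdorffOuter n).isCaratheodory_empty
  measurableSet_compl A hA E := by
    have h : germPreimage E Aᶜ = E.1 \ germPreimage E A := by
      rw [germPreimage, preimage_compl, image_compl_eq_range_sdiff_image Subtype.val_injective,
        Subtype.range_coe, germPreimage]
    rw [h]
    exact (hausdorffOuter n).isCaratheodory_sdiff E.2.rectifiable.isCaratheodory (hA E)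
  measurableSet_iUnion f hf E := by
    have h : germPreimage E (⋃ i, f i) = ⋃ i, germPreimage E (f i) := by
      simp only [germPreimage, preimage_iUnion, image_iUnion]
    rw [h]
    exact (hausdorffOuter n).isCaratheodory_iUnion fun i => hf i E

theorem fiberMeasurableSpace_le_caratheodory {n : ℕ} {Ω : Set (EuclideanSpace ℝ (Fin n))}
    (E : Normalized Ω) :
    fiberMeasurableSpace Ω ≤ (OuterMeasure.map (germMap E)
      (OuterMeasure.comap Subtype.val (hausdorffOuter n))).caratheodory := by
  intro A hA
  rw [OuterMeasure.isCaratheodory_iff]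
  intro t
  have h := hA E (Subtype.val '' (germMap E ⁻¹' t))
  simp only [OuterMeasure.map_apply, OuterMeasure.comap_apply, preimage_inter, preimage_sdiff,
    image_inter Subtype.val_injective, image_sdiff Subtype.val_injective]
  exact h

/-- The measure `μ_E(A) = ℋ^{n-1}(γ_E⁻¹(A))` on `Ω̂` (see `germMeasure_apply`). -/
def germMeasure {n : ℕ} {Ω : Set (EuclideanSpace ℝ (Fin n))} (E : Normalized Ω) :
    Measure (FiberSpace Ω) :=
  (OuterMeasure.map (germMap E) (OuterMeasure.comap Subtype.val (hausdorffOuter n))).toMeasure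
    (fiberMeasurableSpace_le_caratheodory E)

theorem germMeasure_apply {n : ℕ} {Ω : Set (EuclideanSpace ℝ (Fin n))} (E : Normalized Ω)
    {A : Set (FiberSpace Ω)} (hA : MeasurableSet A) :
    germMeasure E A = hausdorffOuter n (germPreimage E A) := by
  rw [germMeasure, toMeasure_apply _ _ hA]
  rfl

/-- The measure on `Ω̂` that is the least upper bound, among all measures, of the `μ_E`, `E ∈ ℰ`. -/
def fiberMeasure {n : ℕ} (Ω : Set (EuclideanSpace ℝ (Fin n))) : Measure (FiberSpace Ω) :=
  ⨆ E : Normalized Ω, germMeasure E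

/-- The outer measure `ℐ^{n-1}` on `Ω`: the supremum over all `(n-1)`-rectifiable `E ⊆ Ω` of the
restrictions of `ℋ^{n-1}` to `E` (see `rectOuter_apply`). -/
def rectOuter {n : ℕ} (Ω : Set (EuclideanSpace ℝ (Fin n))) : OuterMeasure Ω :=
  ⨆ E : {E : Set (EuclideanSpace ℝ (Fin n)) // E ⊆ Ω ∧ IsRectifiable E},
    OuterMeasure.comap Subtype.val (OuterMeasure.restrict E.1 (hausdorffOuter n))

theorem rectOuter_apply {n : ℕ} (Ω : Set (EuclideanSpace ℝ (Fin n))) (S : Set Ω) :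
    rectOuter Ω S =
      ⨆ E : {E : Set (EuclideanSpace ℝ (Fin n)) // E ⊆ Ω ∧ IsRectifiable E},
        hausdorffOuter n (Subtype.val '' S ∩ E.1) := by
  simp [rectOuter, OuterMeasure.iSup_apply]

theorem IsRectifiable.union {n : ℕ} {E F : Set (EuclideanSpace ℝ (Fin n))}
    (hE : IsRectifiable E) (hF : IsRectifiable F) : IsRectifiable (E ∪ F) where
  isCaratheodory := (hausdorffOuter n).isCaratheodory_union hE.isCaratheodory hF.isCaratheodory
  lt_top := (measure_union_le E F).trans_lt (ENNReal.add_lt_top.2 ⟨hE.lt_top, hF.lt_top⟩)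
  countablyRectifiable := by
    obtain ⟨f, hf, hf0⟩ := hE.countablyRectifiable
    obtain ⟨g, hg, hg0⟩ := hF.countablyRectifiable
    refine ⟨fun k => if Even k then f (k / 2) else g (k / 2), fun k => ?_, ?_⟩
    · dsimp only
      split_ifs
      exacts [hf _, hg _]
    · refine measure_mono_null ?_ (measure_union_null hf0 hg0)
      rintro x ⟨hx, hx'⟩
      simp only [mem_iUnion, not_exists] at hx'
      rcases hx with hx | hx
      · refine Or.inl ⟨hx, ?_⟩
        simp only [mem_iUnion, not_exists]
        intro k
        simpa using hx' (2 * k)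
      · refine Or.inr ⟨hx, ?_⟩
        simp only [mem_iUnion, not_exists]
        intro k
        have h := hx' (2 * k + 1)
        rw [if_neg (by simp), show (2 * k + 1) / 2 = k by omega] at h
        exact h

theorem IsRectifiable.empty {n : ℕ} : IsRectifiable (∅ : Set (EuclideanSpace ℝ (Fin n))) where
  isCaratheodory := (hausdorffOuter n).isCaratheodory_empty
  lt_top := by simp
  countablyRectifiable :=
    ⟨fun _ _ => 0, fun _ => ⟨0, LipschitzWith.const 0⟩, by simp⟩

theorem borel_le_rectOuter_caratheodory {n : ℕ} (Ω : Set (EuclideanSpace ℝ (Fin n))) :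
    (inferInstance : MeasurableSpace Ω) ≤ (rectOuter Ω).caratheodory := by
  rintro s ⟨u, hu, rfl⟩
  rw [OuterMeasure.isCaratheodory_iff_le]
  intro t
  simp only [rectOuter_apply]
  have : Nonempty {E : Set (EuclideanSpace ℝ (Fin n)) // E ⊆ Ω ∧ IsRectifiable E} :=
    ⟨⟨∅, empty_subset _, IsRectifiable.empty⟩⟩
  refine ENNReal.iSup_add_iSup_le fun E₁ E₂ => ?_
  refine le_iSup_of_le ⟨E₁.1 ∪ E₂.1, union_subset E₁.2.1 E₂.2.1, E₁.2.2.union E₂.2.2⟩ ?_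
  have hc : (hausdorffOuter n).IsCaratheodory u :=
    le_toOuterMeasure_caratheodory (μHE[n - 1] : Measure (EuclideanSpace ℝ (Fin n))) u hu
  rw [hc (Subtype.val '' t ∩ (E₁.1 ∪ E₂.1))]
  refine add_le_add ((hausdorffOuter n).mono ?_) ((hausdorffOuter n).mono ?_)
  · rintro _ ⟨⟨y, ⟨hy, hyu⟩, rfl⟩, hy'⟩
    exact ⟨⟨⟨y, hy, rfl⟩, Or.inl hy'⟩, hyu⟩
  · rintro _ ⟨⟨y, ⟨hy, hyu⟩, rfl⟩, hy'⟩
    exact ⟨⟨⟨y, hy, rfl⟩, Or.inr hy'⟩, hyu⟩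

/-- The measure `ℐ^{n-1}` on the Borel σ-algebra of `Ω`. -/
def rectMeasure {n : ℕ} (Ω : Set (EuclideanSpace ℝ (Fin n))) : Measure Ω :=
  (rectOuter Ω).toMeasure (borel_le_rectOuter_caratheodory Ω)

theorem rectMeasure_apply {n : ℕ} (Ω : Set (EuclideanSpace ℝ (Fin n))) {S : Set Ω}
    (hS : MeasurableSet S) :
    rectMeasure Ω S =
      ⨆ E : {E : Set (EuclideanSpace ℝ (Fin n)) // E ⊆ Ω ∧ IsRectifiable E},
        hausdorffOuter n (Subtype.val '' S ∩ E.1) := by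
  rw [rectMeasure, toMeasure_apply _ _ hS, rectOuter_apply]

end RectGerm

end

noncomputable section

namespace RectGerm

open Metric Module
open scoped NNReal

/-! The measure `ℐ^{n-1}` need not be σ-finite. A functional `Λ` on `L¹` has a density on each
rectifiable set, but uncountably many such densities, agreeing only almost everywhere on overlaps,
need not glue to a function on `Ω`. They do glue on `Ω̂`. At almost every point of `E ∈ ℰ` the
density is the limit of `Λ(1_{E ∩ B(x,r)}) / (α(n-1) r^{n-1})`, and this limit depends only on the
germ of `E` at `x`: replacing `E` by an equivalent set changes the numerator by at most `‖Λ‖` times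
`o(r^{n-1})` (`HasGermLimit.congr`). The limit is bounded by `‖Λ‖` because members of `ℰ` have
density exactly `1` at their points. This gives surjectivity (`pullbackPairing_germDerivative`).

For the isometry, `p` preserves measure (`measurePreserving_proj`), which bounds the norm of the
functional by that of `g`. Conversely every nonnull `A ⊆ Ω̂` contains, up to a null set, some
`p⁻¹(S)` with `0 < ℐ^{n-1}(S) < ∞` (`exists_measurableSet_proj_preimage_diff_null`), so indicators
of such `S` detect the essential supremum of `g`. The reason is that, up to null sets, a single germ
lies over the points of a given `E ∈ ℰ`: if `E` is almost contained in `G`, their germs coincide at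
all common points (`germMap_eq_germMap`).

The geometric input is that a rectifiable set has density `1` almost everywhere on itself and `0`
almost everywhere off it (`ae_hasDensity_one`, `ae_hasDensity_zero`), so it agrees almost everywhere
with a member of `ℰ` (`exists_normalized`). Density `1` follows from Rademacher's theorem and a
Sard-type lemma, which cut Lipschitz images into almost isometric pieces, and from Lebesgue's
density theorem in the parameter space. -/

/-! ### Covering estimates and zero density off a set of finite measure. -/

theorem _root_.LipschitzOnWith.euclideanHausdorffMeasure_image_le {X Y : Type*} [MetricSpace X]
    [MetricSpace Y] [MeasurableSpace X] [BorelSpace X] [MeasurableSpace Y] [BorelSpace Y]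
    {K : ℝ≥0} {f : X → Y} {s : Set X} (h : LipschitzOnWith K f s) (d : ℕ) :
    μHE[d] (f '' s) ≤ (K : ℝ≥0∞) ^ d * μHE[d] s := by
  simp_rw [Measure.euclideanHausdorffMeasure_def, Measure.smul_apply, Measure.nnreal_smul_coe_apply]
  calc _ ≤ _ * ((K : ℝ≥0∞) ^ (d : ℝ) * μH[d] s) := by
        gcongr; exact h.hausdorffMeasure_image_le (by positivity)
    _ = _ := by rw [ENNReal.rpow_natCast]; ring

/-- Comparison of a finite measure with the Hausdorff measure on a set where its upper density is
bounded below. -/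
theorem hausdorffMeasure_le_of_frequently_le {X : Type*} [MetricSpace X]
    [SecondCountableTopology X] [MeasurableSpace X] [BorelSpace X] (μ : Measure X) {m : ℕ}
    {A U : Set X} (hU : IsOpen U) (hAU : A ⊆ U) {c : ℝ≥0∞} (hc : c ≠ 0) (hc' : c ≠ ∞)
    (h : ∀ x ∈ A, ∃ᶠ r in 𝓝[>] (0 : ℝ), c * ENNReal.ofReal r ^ m ≤ μ (closedBall x r)) :
    μH[m] A ≤ 8 ^ m / c * μ U := by
  have key : ∀ k : ℕ, ∃ u : Set (X × ℝ), u.Countable ∧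
      (∀ p ∈ u, ediam (closedBall p.1 (4 * p.2)) ≤ ENNReal.ofReal (8 / (k + 1))) ∧
      A ⊆ ⋃ p ∈ u, closedBall p.1 (4 * p.2) ∧
      ∑' p : u, ediam (closedBall p.1.1 (4 * p.1.2)) ^ (m : ℝ) ≤ 8 ^ m / c * μ U := by
    intro k
    -- Small heavy balls inside `U`. A disjoint subfamily, enlarged `4` times, still covers `A`; an
    -- enlarged ball has diameter at most `8` times the original radius, whence `8 ^ m`.
    let t : Set (X × ℝ) := {p | p.1 ∈ A ∧ 0 < p.2 ∧ p.2 ≤ 1 / (k + 1) ∧ closedBall p.1 p.2 ⊆ U ∧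
      c * ENNReal.ofReal p.2 ^ m ≤ μ (closedBall p.1 p.2)}
    obtain ⟨u, hut, hdisj, hcov⟩ := Vitali.exists_disjoint_subfamily_covering_enlargement_closedBall
      t Prod.fst Prod.snd (1 / (k + 1)) (fun p hp => hp.2.2.1) 4 (by norm_num)
    have hcount : u.Countable := hdisj.countable_of_nonempty_interior fun p hp =>
      (nonempty_ball.2 (hut hp).2.1).mono ball_subset_interior_closedBall
    have hdiam : ∀ p ∈ u, ediam (closedBall p.1 (4 * p.2)) ≤ 8 * ENNReal.ofReal p.2 := by
      intro p hp
      rw [← closedEBall_ofReal (by have := (hut hp).2.1; positivity)]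
      refine ediam_closedEBall_le.trans ?_
      rw [ENNReal.ofReal_mul (by norm_num)]
      simp only [ENNReal.ofReal_ofNat]
      rw [← mul_assoc]; norm_num
    refine ⟨u, hcount, fun p hp => (hdiam p hp).trans ?_, ?_, ?_⟩
    · have := (hut hp).2.2.1
      rw [show (8 : ℝ≥0∞) = ENNReal.ofReal 8 by simp, ← ENNReal.ofReal_mul (by norm_num)]
      refine ENNReal.ofReal_le_ofReal ?_
      calc 8 * p.2 ≤ 8 * (1 / (k + 1)) := by gcongr
        _ = _ := by ring
    · intro x hx
      obtain ⟨ε, hε, hεU⟩ := Metric.isOpen_iff.1 hU x (hAU hx)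
      have h1 : ∀ᶠ r in 𝓝[>] (0 : ℝ), r ∈ Ioo 0 (min ε (1 / (k + 1))) :=
        Ioo_mem_nhdsGT (lt_min hε (by positivity))
      obtain ⟨r, hr, hr'⟩ := ((h x hx).and_eventually h1).exists
      have hxt : (x, r) ∈ t := ⟨hx, hr'.1, (hr'.2.trans_le (min_le_right _ _)).le,
        (closedBall_subset_ball (hr'.2.trans_le (min_le_left _ _))).trans hεU, hr⟩
      obtain ⟨b, hb, hb'⟩ := hcov _ hxt
      exact mem_iUnion₂.2 ⟨b, hb, hb' (mem_closedBall_self hr'.1.le)⟩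
    · have := hcount.to_subtype
      calc ∑' p : u, ediam (closedBall p.1.1 (4 * p.1.2)) ^ (m : ℝ)
          ≤ ∑' p : u, 8 ^ m / c * μ (closedBall p.1.1 p.1.2) := by
            refine ENNReal.tsum_le_tsum fun p => ?_
            rw [ENNReal.rpow_natCast]
            calc _ ≤ (8 * ENNReal.ofReal p.1.2) ^ m := by gcongr; exact hdiam _ p.2
              _ = 8 ^ m / c * (c * ENNReal.ofReal p.1.2 ^ m) := by
                rw [mul_pow, ← mul_assoc, ENNReal.div_mul_cancel hc hc']
              _ ≤ _ := by gcongr; exact (hut p.2).2.2.2.2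
        _ = 8 ^ m / c * μ (⋃ p : u, closedBall p.1.1 p.1.2) := by
            rw [ENNReal.tsum_mul_left, measure_iUnion]
            · intro p q hpq
              exact hdisj p.2 q.2 (fun h => hpq (Subtype.ext h))
            · exact fun p => isClosed_closedBall.measurableSet
        _ ≤ _ := by
            gcongr
            exact iUnion_subset fun p => (hut p.2).2.2.2.1
  choose u hcount hdiam hcov hsum using key
  have := fun k => (hcount k).to_subtype
  have hlim : Tendsto (fun k : ℕ => ENNReal.ofReal (8 / (k + 1))) atTop (𝓝 0) := by
    rw [← ENNReal.ofReal_zero]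
    refine ENNReal.tendsto_ofReal ?_
    simpa [div_eq_mul_inv] using (tendsto_one_div_add_atTop_nhds_zero_nat (𝕜 := ℝ)).const_mul 8
  refine (Measure.hausdorffMeasure_le_liminf_tsum (m : ℝ) A (l := atTop) _ hlim
    (fun k (p : u k) => closedBall p.1.1 (4 * p.1.2))
    (Eventually.of_forall fun k p => hdiam k p p.2)
    (Eventually.of_forall fun k => ?_)).trans ?_
  · rw [iUnion_subtype]; exact hcov k
  · refine (liminf_le_liminf (Eventually.of_forall hsum)).trans ?_
    simp

theorem volume_closedBall_zero_one_ne_zero (m : ℕ) :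
    volume (closedBall (0 : EuclideanSpace ℝ (Fin m)) 1) ≠ 0 :=
  (measure_closedBall_pos _ _ one_pos).ne'

theorem volume_closedBall_zero_one_ne_top (m : ℕ) :
    volume (closedBall (0 : EuclideanSpace ℝ (Fin m)) 1) ≠ ∞ :=
  measure_closedBall_lt_top.ne

theorem euclideanHausdorffMeasure_eq_zero {X : Type*} [MetricSpace X] [MeasurableSpace X]
    [BorelSpace X] {m : ℕ} {s : Set X} (h : μH[m] s = 0) : (μHE[m] : Measure X) s = 0 := by
  simp [Measure.euclideanHausdorffMeasure_def, h]

variable {n : ℕ}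

/-- Almost every point outside a Borel set of finite measure is a point of density zero. -/
theorem ae_hasDensity_zero {E : Set (EuclideanSpace ℝ (Fin n))} (hE : MeasurableSet E)
    (hfin : μHE[n - 1] E ≠ ∞) :
    ∀ᵐ x ∂(μHE[n - 1] : Measure (EuclideanSpace ℝ (Fin n))), x ∉ E → HasDensity E x 0 := by
  set m := n - 1 with hm
  set α := volume (closedBall (0 : EuclideanSpace ℝ (Fin m)) 1) with hα
  have hα0 : α ≠ 0 := volume_closedBall_zero_one_ne_zero m
  have hα1 : α ≠ ∞ := volume_closedBall_zero_one_ne_top m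
  set μ : Measure (EuclideanSpace ℝ (Fin n)) := μHE[m].restrict E with hμ
  have hμfin : IsFiniteMeasure μ := ⟨by simpa [hμ] using hfin.lt_top⟩
  let A : ℕ → Set (EuclideanSpace ℝ (Fin n)) := fun k => {x | x ∉ E ∧
    ∃ᶠ r in 𝓝[>] (0 : ℝ), ((k : ℝ≥0∞) + 1)⁻¹ * α * ENNReal.ofReal r ^ m ≤ μ (closedBall x r)}
  -- `A k` lies off `E`, hence is `μ`-null, and by outer regularity it sits in open sets of
  -- arbitrarily small `μ`-measure; the covering estimate then makes its Hausdorff measure small.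
  have hA : ∀ k, μHE[m] (A k) = 0 := by
    intro k
    apply euclideanHausdorffMeasure_eq_zero
    have hμA : μ (A k) = 0 := by
      refine measure_mono_null (t := Eᶜ) (fun x hx => hx.1) ?_
      rw [hμ, Measure.restrict_apply hE.compl]; simp
    set c := ((k : ℝ≥0∞) + 1)⁻¹ * α
    have hk1 : ((k : ℝ≥0∞) + 1) ≠ ∞ := by finiteness
    have hc : c ≠ 0 := mul_ne_zero (ENNReal.inv_ne_zero.2 hk1) hα0
    have hc' : c ≠ ∞ := ENNReal.mul_ne_top (ENNReal.inv_ne_top.2 (by simp)) hα1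
    have hC : (8 : ℝ≥0∞) ^ m / c ≠ ∞ := ENNReal.div_ne_top (by finiteness) hc
    refine le_antisymm (ENNReal.le_of_forall_pos_le_add fun ε hε _ => ?_) zero_le
    have hε' : (ε : ℝ≥0∞) / (8 ^ m / c) ≠ 0 :=
      ENNReal.div_ne_zero.2 ⟨by exact_mod_cast hε.ne', hC⟩
    obtain ⟨U, hAU, hU, hμU⟩ := (A k).exists_isOpen_lt_of_lt (μ := μ) _
      (hμA.trans_lt (pos_iff_ne_zero.2 hε'))
    refine (hausdorffMeasure_le_of_frequently_le μ hU hAU hc hc' fun x hx => hx.2).trans ?_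
    rw [zero_add]
    calc _ ≤ 8 ^ m / c * (ε / (8 ^ m / c)) := by gcongr
      _ ≤ ε := ENNReal.mul_div_le
  have hall : ∀ᵐ x ∂(μHE[m] : Measure (EuclideanSpace ℝ (Fin n))), ∀ k, x ∉ A k :=
    ae_all_iff.2 fun k => measure_eq_zero_iff_ae_notMem.1 (hA k)
  filter_upwards [hall] with x hx hxE
  rw [HasDensity, ENNReal.tendsto_nhds_zero]
  intro ε hε
  obtain ⟨k, hk⟩ := ENNReal.exists_inv_nat_lt hε.ne'
  have hxk : ¬ ∃ᶠ r in 𝓝[>] (0 : ℝ),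
      ((k : ℝ≥0∞) + 1)⁻¹ * α * ENNReal.ofReal r ^ m ≤ μ (closedBall x r) :=
    fun h => hx k ⟨hxE, h⟩
  filter_upwards [not_frequently.1 hxk] with r hr
  refine ENNReal.div_le_of_le_mul ?_
  have : hausdorffOuter n (E ∩ closedBall x r) = μ (closedBall x r) := by
    rw [hμ, Measure.restrict_apply isClosed_closedBall.measurableSet, inter_comm]; rfl
  rw [this]
  refine (not_le.1 hr).le.trans ?_
  rw [mul_assoc]
  gcongr
  exact (ENNReal.inv_le_inv.2 le_self_add).trans hk.le

theorem volume_closedBall_eq {m : ℕ} (x : EuclideanSpace ℝ (Fin m)) {r : ℝ} (hr : 0 ≤ r) :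
    volume (closedBall x r) =
      volume (closedBall (0 : EuclideanSpace ℝ (Fin m)) 1) * ENNReal.ofReal r ^ m := by
  rw [Measure.addHaar_closedBall' _ _ hr, finrank_euclideanSpace_fin, ENNReal.ofReal_pow hr,
    mul_comm]

theorem densityDenominator_ne_zero (m : ℕ) {r : ℝ} (hr : 0 < r) :
    volume (closedBall (0 : EuclideanSpace ℝ (Fin m)) 1) * ENNReal.ofReal r ^ m ≠ 0 :=
  mul_ne_zero (volume_closedBall_zero_one_ne_zero m)
    (pow_ne_zero _ (ENNReal.ofReal_pos.2 hr).ne')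

theorem densityDenominator_ne_top (m : ℕ) (r : ℝ) :
    volume (closedBall (0 : EuclideanSpace ℝ (Fin m)) 1) * ENNReal.ofReal r ^ m ≠ ∞ :=
  ENNReal.mul_ne_top (volume_closedBall_zero_one_ne_top m) (by finiteness)

/-! ### Densities of bi-Lipschitz images. -/

section BiLipschitz

variable {ψ : EuclideanSpace ℝ (Fin (n - 1)) → EuclideanSpace ℝ (Fin n)}
  {S : Set (EuclideanSpace ℝ (Fin (n - 1)))} {K : ℝ≥0}

/-- One factor `K ^ (n - 1)` comes from pulling the ball of radius `r` back into a ball of radius `K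
* r`, the other from pushing the measure forward. -/
theorem densityRatio_image_le (hL : LipschitzOnWith K ψ S)
    (hA : ∀ x ∈ S, ∀ y ∈ S, dist x y ≤ K * dist (ψ x) (ψ y)) {y : EuclideanSpace ℝ (Fin n)}
    (hy : y ∈ ψ '' S) {r : ℝ} (hr : 0 < r) :
    densityRatio (ψ '' S) y r ≤ (K : ℝ≥0∞) ^ (2 * (n - 1)) := by
  obtain ⟨x, hx, rfl⟩ := hy
  have hsub : ψ '' S ∩ closedBall (ψ x) r ⊆ ψ '' (S ∩ closedBall x (K * r)) := by
    rintro _ ⟨⟨z, hz, rfl⟩, hz'⟩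
    refine ⟨z, ⟨hz, ?_⟩, rfl⟩
    rw [mem_closedBall] at hz' ⊢
    exact (hA z hz x hx).trans (by gcongr)
  refine ENNReal.div_le_of_le_mul ?_
  calc hausdorffOuter n (ψ '' S ∩ closedBall (ψ x) r)
      ≤ μHE[n - 1] (ψ '' (S ∩ closedBall x (K * r))) := measure_mono hsub
    _ ≤ (K : ℝ≥0∞) ^ (n - 1) * μHE[n - 1] (S ∩ closedBall x (K * r)) :=
        (hL.mono inter_subset_left).euclideanHausdorffMeasure_image_le _
    _ ≤ (K : ℝ≥0∞) ^ (n - 1) * volume (closedBall x (K * r)) := by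
        rw [EuclideanSpace.euclideanHausdorffMeasure_eq_volume]
        gcongr
        exact inter_subset_right
    _ = _ := by
        rw [volume_closedBall_eq _ (by positivity), ENNReal.ofReal_mul (by positivity),
          ENNReal.ofReal_coe_nnreal]
        ring

theorem injOn_of_dist_le (hA : ∀ x ∈ S, ∀ y ∈ S, dist x y ≤ K * dist (ψ x) (ψ y)) :
    InjOn ψ S := by
  intro x hx y hy hxy
  have := hA x hx y hy
  rw [hxy, dist_self, mul_zero] at this
  exact dist_le_zero.1 this

theorem volume_le_image (hA : ∀ x ∈ S, ∀ y ∈ S, dist x y ≤ K * dist (ψ x) (ψ y))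
    {T : Set (EuclideanSpace ℝ (Fin (n - 1)))} (hT : T ⊆ S) :
    volume T ≤ (K : ℝ≥0∞) ^ (n - 1) * μHE[n - 1] (ψ '' T) := by
  have hinj := (injOn_of_dist_le hA).mono hT
  have hinv : LipschitzOnWith K (Function.invFunOn ψ T) (ψ '' T) := by
    refine LipschitzOnWith.of_dist_le_mul ?_
    rintro _ ⟨a, ha, rfl⟩ _ ⟨b, hb, rfl⟩
    rw [hinj.leftInvOn_invFunOn ha, hinj.leftInvOn_invFunOn hb]
    exact hA a (hT ha) b (hT hb)
  have := hinv.euclideanHausdorffMeasure_image_le (n - 1)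
  rwa [hinj.leftInvOn_invFunOn.image_image,
    EuclideanSpace.euclideanHausdorffMeasure_eq_volume] at this

/-- Lebesgue's density theorem for `S`, transported by `ψ`. Shrinking the ball to radius `r / K` and
inverting `ψ` each cost `K ^ (n - 1)`; the extra factor `K` is there because the density ratio of
`S` is eventually above `K⁻¹ < 1`. -/
theorem ae_le_densityRatio_image (hS : MeasurableSet S) (hK : 1 < K) (hL : LipschitzOnWith K ψ S)
    (hA : ∀ x ∈ S, ∀ y ∈ S, dist x y ≤ K * dist (ψ x) (ψ y)) :
    ∀ᵐ y ∂(μHE[n - 1] : Measure (EuclideanSpace ℝ (Fin n))), y ∈ ψ '' S →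
      ∀ᶠ r in 𝓝[>] (0 : ℝ), ((K : ℝ≥0∞) ^ (2 * (n - 1) + 1))⁻¹ ≤ densityRatio (ψ '' S) y r := by
  have hK0 : K ≠ 0 := (zero_lt_one.trans hK).ne'
  let N : Set (EuclideanSpace ℝ (Fin (n - 1))) := {x | ¬ (x ∈ S → Tendsto
    (fun r => volume (S ∩ closedBall x r) / volume (closedBall x r)) (𝓝[>] 0) (𝓝 1))}
  have hN : volume N = 0 :=
    ae_iff.1 ((ae_restrict_iff' hS).1 (Besicovitch.ae_tendsto_measure_inter_div volume S))
  have hNS : N ⊆ S := fun x hx => by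
    by_contra h
    exact hx fun h' => absurd h' h
  have hψN : μHE[n - 1] (ψ '' N) = 0 := by
    refine le_antisymm (((hL.mono hNS).euclideanHausdorffMeasure_image_le _).trans ?_) zero_le
    rw [EuclideanSpace.euclideanHausdorffMeasure_eq_volume, hN, mul_zero]
  filter_upwards [measure_eq_zero_iff_ae_notMem.1 hψN] with y hyN hy
  obtain ⟨x, hx, rfl⟩ := hy
  have hxN : x ∉ N := fun h => hyN (mem_image_of_mem _ h)
  have hlim : Tendsto (fun r => volume (S ∩ closedBall x r) / volume (closedBall x r))
      (𝓝[>] 0) (𝓝 1) := not_not.1 hxN hx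
  have hscale : Tendsto (fun r : ℝ => r / K) (𝓝[>] 0) (𝓝[>] 0) := by
    refine tendsto_nhdsWithin_iff.2 ⟨?_, ?_⟩
    · have : Tendsto (fun r : ℝ => r / K) (𝓝 0) (𝓝 (0 / K)) := tendsto_id.div_const _
      rw [zero_div] at this
      exact this.mono_left nhdsWithin_le_nhds
    · filter_upwards [self_mem_nhdsWithin] with r hr
      exact div_pos (mem_Ioi.1 hr) (by exact_mod_cast pos_iff_ne_zero.2 hK0)
  have hKi : (K : ℝ≥0∞)⁻¹ < 1 := ENNReal.inv_lt_one.2 (by exact_mod_cast hK)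
  filter_upwards [hscale.eventually (hlim.eventually (lt_mem_nhds hKi)), self_mem_nhdsWithin]
    with r hr hr0
  have hr0 : 0 < r := hr0
  have hrK : 0 ≤ r / K := by positivity
  have hsub : ψ '' (S ∩ closedBall x (r / K)) ⊆ ψ '' S ∩ closedBall (ψ x) r := by
    rintro _ ⟨z, ⟨hz, hz'⟩, rfl⟩
    refine ⟨mem_image_of_mem _ hz, ?_⟩
    rw [mem_closedBall] at hz' ⊢
    refine (hL.dist_le_mul z hz x hx).trans ?_
    calc (K : ℝ) * dist z x ≤ K * (r / K) := by gcongr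
      _ = r := by field_simp
  have h1 : (K : ℝ≥0∞)⁻¹ * volume (closedBall x (r / K)) ≤ volume (S ∩ closedBall x (r / K)) :=
    ENNReal.mul_le_of_le_div hr.le
  have h2 : volume (S ∩ closedBall x (r / K)) ≤
      (K : ℝ≥0∞) ^ (n - 1) * hausdorffOuter n (ψ '' S ∩ closedBall (ψ x) r) :=
    (volume_le_image hA inter_subset_left).trans (by gcongr; exact measure_mono hsub)
  rw [densityRatio, ENNReal.le_div_iff_mul_le (Or.inl (densityDenominator_ne_zero _ hr0))
    (Or.inl (densityDenominator_ne_top _ _))]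
  have hKt : (K : ℝ≥0∞) ≠ 0 := by exact_mod_cast hK0
  have h3 : volume (closedBall (0 : EuclideanSpace ℝ (Fin (n - 1))) 1) * ENNReal.ofReal r ^ (n - 1) =
      (K : ℝ≥0∞) ^ (n - 1) * volume (closedBall x (r / K)) := by
    rw [volume_closedBall_eq _ hrK]
    have : ENNReal.ofReal r = K * ENNReal.ofReal (r / K) := by
      rw [← ENNReal.ofReal_coe_nnreal, ← ENNReal.ofReal_mul (by positivity)]
      congr 1
      field_simp
    rw [this]; ring
  rw [h3]
  have hne : (K : ℝ≥0∞) ^ (2 * (n - 1) + 1) ≠ 0 := pow_ne_zero _ hKt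
  rw [ENNReal.inv_mul_le_iff hne (by finiteness)]
  calc (K : ℝ≥0∞) ^ (n - 1) * volume (closedBall x (r / K))
      = K ^ (n - 1 + 1) * ((K : ℝ≥0∞)⁻¹ * volume (closedBall x (r / K))) := by
        rw [← mul_assoc, pow_succ, mul_assoc _ (K : ℝ≥0∞), ENNReal.mul_inv_cancel hKt (by simp),
          mul_one]
    _ ≤ K ^ (n - 1 + 1) * (K ^ (n - 1) * hausdorffOuter n (ψ '' S ∩ closedBall (ψ x) r)) := by
        gcongr _ * ?_; exact h1.trans h2
    _ = _ := by ring

end BiLipschitz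

/-! ### A Sard-type lemma for points with non-injective differential. -/

section Sard

variable {U V : Type*} [NormedAddCommGroup U] [InnerProductSpace ℝ U]
  [NormedAddCommGroup V] [InnerProductSpace ℝ V]

/-- The map `x ↦ (A x, ε x)`. -/
def graphPerturbation (A : U →L[ℝ] V) (ε : ℝ) : U →L[ℝ] WithLp 2 (V × U) :=
  (WithLp.prodContinuousLinearEquiv 2 ℝ V U).symm.toContinuousLinearMap ∘L
    (A.prod (ε • ContinuousLinearMap.id ℝ U))

theorem graphPerturbation_apply (A : U →L[ℝ] V) (ε : ℝ) (x : U) :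
    graphPerturbation A ε x = WithLp.toLp 2 (A x, ε • x) := rfl

theorem norm_le_norm_graphPerturbation (A : U →L[ℝ] V) (ε : ℝ) (x : U) :
    ‖A x‖ ≤ ‖graphPerturbation A ε x‖ := by
  have := WithLp.prod_norm_sq_eq_of_L2 (graphPerturbation A ε x)
  simp only [graphPerturbation_apply] at this ⊢
  refine le_of_sq_le_sq ?_ (norm_nonneg _)
  rw [this]
  exact le_add_of_nonneg_right (sq_nonneg _)

theorem norm_smul_le_norm_graphPerturbation (A : U →L[ℝ] V) (ε : ℝ) (x : U) :
    ‖ε • x‖ ≤ ‖graphPerturbation A ε x‖ := by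
  have := WithLp.prod_norm_sq_eq_of_L2 (graphPerturbation A ε x)
  simp only [graphPerturbation_apply] at this ⊢
  refine le_of_sq_le_sq ?_ (norm_nonneg _)
  rw [this]
  exact le_add_of_nonneg_left (sq_nonneg _)

variable [FiniteDimensional ℝ U]

/-- The perturbation `T x = (A x, r x)` is injective and controls `f`: both `‖A (x - y)‖` and `r *
‖x - y‖` are at most `‖T (x - y)‖`. So `f` factors through `T` by a `2`-Lipschitz map, and the
measure of `T '' s` is given by the Jacobian of `T`. -/
theorem euclideanHausdorffMeasure_image_le_of_approximatesLinearOn [MeasurableSpace U]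
    [BorelSpace U] [MeasurableSpace V] [BorelSpace V] {f : U → V} {A : U →L[ℝ] V} {s : Set U}
    {r : ℝ≥0} (hr : 0 < r) (h : ApproximatesLinearOn f A s r) :
    μHE[finrank ℝ U] (f '' s) ≤ 2 ^ finrank ℝ U *
      (ENNReal.ofReal (graphPerturbation A r).toLinearMap.normDet * volume s) := by
  let _ : MeasurableSpace (WithLp 2 (V × U)) := borel _
  have : BorelSpace (WithLp 2 (V × U)) := ⟨rfl⟩
  set T := graphPerturbation A r with hT
  have hbound : ∀ x ∈ s, ∀ y ∈ s, dist (f x) (f y) ≤ 2 * dist (T x) (T y) := by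
    intro x hx y hy
    have h1 := norm_le_norm_graphPerturbation A r (x - y)
    have h2 := norm_smul_le_norm_graphPerturbation A r (x - y)
    have h3 := h x hx y hy
    rw [norm_smul, NNReal.norm_eq] at h2
    rw [dist_eq_norm, dist_eq_norm, ← map_sub]
    calc ‖f x - f y‖ = ‖(f x - f y - A (x - y)) + A (x - y)‖ := by rw [sub_add_cancel]
      _ ≤ ‖f x - f y - A (x - y)‖ + ‖A (x - y)‖ := norm_add_le _ _
      _ ≤ _ := by linarith
  have hinj : Function.Injective T := by
    intro x y hxy
    have h2 := norm_smul_le_norm_graphPerturbation A r (x - y)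
    rw [← hT, map_sub, hxy, sub_self, norm_zero, norm_smul, NNReal.norm_eq] at h2
    have hr' : (0 : ℝ) < r := hr
    have : ‖x - y‖ ≤ 0 := by
      by_contra! h'
      exact absurd h2 (not_le.2 (by positivity))
    exact sub_eq_zero.1 (norm_le_zero_iff.1 this)
  have hinv := Function.leftInverse_invFun hinj
  have hlip : LipschitzOnWith 2 (f ∘ Function.invFun T) (T '' s) := by
    refine LipschitzOnWith.of_dist_le_mul ?_
    rintro _ ⟨x, hx, rfl⟩ _ ⟨y, hy, rfl⟩
    simp only [Function.comp, hinv x, hinv y]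
    exact hbound x hx y hy
  have := hlip.euclideanHausdorffMeasure_image_le (finrank ℝ U)
  rw [image_comp, hinv.image_image] at this
  refine this.trans_eq ?_
  have hdet := T.toLinearMap.euclideanHausdorffMeasure_image_eq_normDet_mul_volume s
  rw [ContinuousLinearMap.coe_coe] at hdet
  rw [hdet]
  simp

variable [FiniteDimensional ℝ V]

theorem normDet_graphPerturbation_sq (A : U →L[ℝ] V) (ε : ℝ) :
    (graphPerturbation A ε).toLinearMap.normDet ^ 2 =
      ((ContinuousLinearMap.adjoint A) ∘L A + ε ^ 2 • ContinuousLinearMap.id ℝ U).det := by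
  have h := (graphPerturbation A ε).normDet_sq
  rw [show (ContinuousLinearMap.adjoint A) ∘L A + ε ^ 2 • ContinuousLinearMap.id ℝ U =
    (ContinuousLinearMap.adjoint (graphPerturbation A ε)) ∘L graphPerturbation A ε from ?_]
  · exact h
  · refine ContinuousLinearMap.ext fun x => ext_inner_right ℝ fun y => ?_
    simp only [ContinuousLinearMap.comp_apply, add_apply,
      smul_apply, ContinuousLinearMap.id_apply,
      ContinuousLinearMap.adjoint_inner_left, inner_add_left, graphPerturbation_apply,
      WithLp.prod_inner_apply, real_inner_smul_left, real_inner_smul_right]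
    ring

/-- The squared Jacobian `det (A* A + ε² I)` is continuous in `ε`, and at `ε = 0` it is the squared
Jacobian of a non-injective map. -/
theorem tendsto_normDet_graphPerturbation {A : U →L[ℝ] V} (hA : ¬ Function.Injective A) :
    Tendsto (fun ε : ℝ => (graphPerturbation A ε).toLinearMap.normDet) (𝓝 0) (𝓝 0) := by
  have h0 : A.toLinearMap.normDet = 0 := by
    by_contra h
    exact hA ((A.toLinearMap.normDet_ne_zero_tfae.out 0 4).1 h)
  have h1 : ((ContinuousLinearMap.adjoint A) ∘L A).det = 0 := by
    have := A.normDet_sq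
    rw [h0] at this
    simpa using this.symm
  have h2 : Tendsto (fun ε : ℝ =>
      ((ContinuousLinearMap.adjoint A) ∘L A + ε ^ 2 • ContinuousLinearMap.id ℝ U).det)
      (𝓝 0) (𝓝 0) := by
    have hc : Continuous fun ε : ℝ =>
        ((ContinuousLinearMap.adjoint A) ∘L A + ε ^ 2 • ContinuousLinearMap.id ℝ U).det :=
      ContinuousLinearMap.continuous_det.comp (by fun_prop)
    have := hc.tendsto 0
    simpa [h1] using this
  have h3 := h2.sqrt
  simp_rw [← normDet_graphPerturbation_sq, Real.sqrt_sq (LinearMap.normDet_nonneg _)] at h3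
  simpa using h3

/-- **Sard-type lemma**: the image of the set of the points where the differential is not injective
is negligible. -/
theorem euclideanHausdorffMeasure_image_of_not_injective [MeasurableSpace U]
    [BorelSpace U] [MeasurableSpace V] [BorelSpace V] (f : U → V) {s : Set U}
    (hf : ∀ x ∈ s, DifferentiableAt ℝ f x)
    (hs : ∀ x ∈ s, ¬ Function.Injective (fderiv ℝ f x)) : μHE[finrank ℝ U] (f '' s) = 0 := by
  have hball : ∀ k : ℕ, μHE[finrank ℝ U] (f '' (s ∩ closedBall 0 k)) = 0 := by
    intro k
    set M := volume (closedBall (0 : U) k) with hM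
    have hMfin : M ≠ ∞ := measure_closedBall_lt_top.ne
    have hle : ∀ η : ℝ≥0, 0 < η →
        μHE[finrank ℝ U] (f '' (s ∩ closedBall 0 k)) ≤ 2 ^ finrank ℝ U * (η * M) := by
      intro η hη
      -- The approximation scale is chosen for each linear map so that the perturbed Jacobian is at
      -- most `η`; for injective maps the value is irrelevant.
      have hex : ∀ A : U →L[ℝ] V, ∃ r : ℝ≥0, r ≠ 0 ∧ (¬ Function.Injective A →
          ENNReal.ofReal (graphPerturbation A r).toLinearMap.normDet ≤ η) := by
        intro A
        by_cases hA : Function.Injective A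
        · exact ⟨1, one_ne_zero, fun h => absurd hA h⟩
        have h1 := (tendsto_normDet_graphPerturbation hA).eventually (gt_mem_nhds hη)
        have h2 : ∀ᶠ ε in 𝓝[>] (0 : ℝ), (graphPerturbation A ε).toLinearMap.normDet < η :=
          h1.filter_mono nhdsWithin_le_nhds
        obtain ⟨ε, hε, hε0⟩ := (h2.and self_mem_nhdsWithin).exists
        have hε0 : 0 < ε := hε0
        lift ε to ℝ≥0 using hε0.le
        refine ⟨ε, by rintro rfl; simp at hε0, fun _ => ?_⟩
        rw [← ENNReal.ofReal_coe_nnreal]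
        exact ENNReal.ofReal_le_ofReal hε.le
      choose r hr0 hr using hex
      obtain ⟨t, A, htd, htm, hst, happ, hA⟩ :=
        exists_partition_approximatesLinearOn_of_hasFDerivWithinAt f (s ∩ closedBall 0 k)
          (fderiv ℝ f) (fun x hx => (hf x hx.1).hasFDerivAt.hasFDerivWithinAt) r hr0
      rcases (s ∩ closedBall 0 k).eq_empty_or_nonempty with he | hne
      · simp [he]
      calc μHE[finrank ℝ U] (f '' (s ∩ closedBall 0 k))
          ≤ μHE[finrank ℝ U] (⋃ i, f '' (s ∩ closedBall 0 k ∩ t i)) := by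
            rw [← image_iUnion, ← inter_iUnion]
            exact measure_mono (image_mono (subset_inter Subset.rfl hst))
        _ ≤ ∑' i, μHE[finrank ℝ U] (f '' (s ∩ closedBall 0 k ∩ t i)) := measure_iUnion_le _
        _ ≤ ∑' i, 2 ^ finrank ℝ U * (η * volume (closedBall 0 k ∩ t i)) := by
            refine ENNReal.tsum_le_tsum fun i => ?_
            refine (euclideanHausdorffMeasure_image_le_of_approximatesLinearOn
              (pos_iff_ne_zero.2 (hr0 (A i))) (happ i)).trans ?_
            -- Each approximating map is the differential at some point of `s`, hence is not
            -- injective.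
            obtain ⟨y, hy, hAy⟩ := hA hne i
            gcongr
            · exact hr _ (hAy ▸ hs y hy.1)
            · exact inter_subset_right
        _ = 2 ^ finrank ℝ U * (η * volume (⋃ i, closedBall 0 k ∩ t i)) := by
            rw [ENNReal.tsum_mul_left, ENNReal.tsum_mul_left, measure_iUnion]
            · exact fun i j hij => (htd hij).mono inter_subset_right inter_subset_right
            · exact fun i => isClosed_closedBall.measurableSet.inter (htm i)
        _ ≤ _ := by
            gcongr _ * (_ * ?_)
            exact measure_mono (iUnion_subset fun i => inter_subset_left)
    have hlim : Tendsto (fun η : ℝ≥0 => 2 ^ finrank ℝ U * ((η : ℝ≥0∞) * M)) (𝓝[>] 0) (𝓝 0) := by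
      have h1 : Tendsto (fun η : ℝ≥0 => (η : ℝ≥0∞)) (𝓝[>] 0) (𝓝 0) :=
        (ENNReal.tendsto_coe.2 tendsto_id).mono_left nhdsWithin_le_nhds
      have h2 := ENNReal.Tendsto.const_mul (a := 2 ^ finrank ℝ U)
        (ENNReal.Tendsto.mul_const (b := M) h1 (Or.inr hMfin)) (Or.inr (by finiteness))
      simpa using h2
    refine le_antisymm (ge_of_tendsto hlim ?_) zero_le
    filter_upwards [self_mem_nhdsWithin] with η hη using hle η hη
  have hcov : f '' s ⊆ ⋃ k : ℕ, f '' (s ∩ closedBall 0 k) := by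
    rintro _ ⟨x, hx, rfl⟩
    obtain ⟨k, hk⟩ := exists_nat_ge ‖x‖
    exact mem_iUnion.2 ⟨k, x, ⟨hx, by simpa using hk⟩, rfl⟩
  exact measure_mono_null hcov (measure_iUnion_null hball)

end Sard

/-! ### Decomposition of Lipschitz images into almost isometric pieces. -/

/-- An isometry of `U` onto the range of `A` is pulled back through `A`. Reparametrizing by `e`
turns an injective differential into an isometric one. -/
theorem exists_equiv_norm_apply_eq {U V : Type*} [NormedAddCommGroup U] [InnerProductSpace ℝ U]
    [FiniteDimensional ℝ U] [NormedAddCommGroup V] [InnerProductSpace ℝ V]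
    {A : U →L[ℝ] V} (hA : Function.Injective A) :
    ∃ e : U ≃L[ℝ] U, ∀ x, ‖A (e x)‖ = ‖x‖ := by
  obtain ⟨b⟩ := (A.toLinearMap.normDet_ne_zero_tfae.out 4 3).1 hA
  let g : U ≃ₗᵢ[ℝ] A.toLinearMap.range := (stdOrthonormalBasis ℝ U).equiv b (Equiv.refl _)
  let a : U ≃ₗ[ℝ] A.toLinearMap.range := LinearEquiv.ofInjective A.toLinearMap hA
  refine ⟨(g.toLinearEquiv.trans a.symm).toContinuousLinearEquiv, fun x => ?_⟩
  have : A (a.symm (g x)) = g x := congrArg Subtype.val (a.apply_symm_apply (g x))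
  calc _ = ‖(g x : V)‖ := by rw [← this]; rfl
    _ = _ := g.norm_map x

/-- A `K`-bi-Lipschitz parametrized piece. -/
structure IsBiLipschitzPiece (K : ℝ≥0)
    (ψ : EuclideanSpace ℝ (Fin (n - 1)) → EuclideanSpace ℝ (Fin n))
    (S : Set (EuclideanSpace ℝ (Fin (n - 1)))) : Prop where
  measurableSet : MeasurableSet S
  volume_ne_top : volume S ≠ ∞
  lipschitzOnWith : LipschitzOnWith K ψ S
  dist_le : ∀ x ∈ S, ∀ y ∈ S, dist x y ≤ K * dist (ψ x) (ψ y)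

theorem IsBiLipschitzPiece.measurableSet_image {K : ℝ≥0}
    {ψ : EuclideanSpace ℝ (Fin (n - 1)) → EuclideanSpace ℝ (Fin n)}
    {S : Set (EuclideanSpace ℝ (Fin (n - 1)))} (h : IsBiLipschitzPiece K ψ S) :
    MeasurableSet (ψ '' S) :=
  h.measurableSet.image_of_continuousOn_injOn h.lipschitzOnWith.continuousOn
    (injOn_of_dist_le h.dist_le)

theorem IsBiLipschitzPiece.image_ne_top {K : ℝ≥0}
    {ψ : EuclideanSpace ℝ (Fin (n - 1)) → EuclideanSpace ℝ (Fin n)}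
    {S : Set (EuclideanSpace ℝ (Fin (n - 1)))} (h : IsBiLipschitzPiece K ψ S) :
    μHE[n - 1] (ψ '' S) ≠ ∞ := by
  refine ne_top_of_le_ne_top ?_ (h.lipschitzOnWith.euclideanHausdorffMeasure_image_le (n - 1))
  rw [EuclideanSpace.euclideanHausdorffMeasure_eq_volume]
  exact ENNReal.mul_ne_top (by finiteness) h.volume_ne_top

/-- `f ∘ e` differs from the isometry `A ∘ e` by an error with Lipschitz constant at most `1 - K⁻¹`.
The lower constant is then `K⁻¹`, and the upper one is `2 - K⁻¹`, at most `K` because `(K - 1) ^ 2 /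
K ≥ 0`. -/
theorem isBiLipschitzPiece_of_approximatesLinearOn {K : ℝ≥0} (hK : 1 < K)
    {f : EuclideanSpace ℝ (Fin (n - 1)) → EuclideanSpace ℝ (Fin n)}
    {A : EuclideanSpace ℝ (Fin (n - 1)) →L[ℝ] EuclideanSpace ℝ (Fin n)}
    {e : EuclideanSpace ℝ (Fin (n - 1)) ≃L[ℝ] EuclideanSpace ℝ (Fin (n - 1))}
    (he : ∀ x, ‖A (e x)‖ = ‖x‖) {r : ℝ≥0}
    (hr : (r : ℝ) * ‖e.toContinuousLinearMap‖ ≤ 1 - (K : ℝ)⁻¹)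
    {s : Set (EuclideanSpace ℝ (Fin (n - 1)))} (hs : MeasurableSet s) (hsb : Bornology.IsBounded s)
    (hf : ApproximatesLinearOn f A s r) : IsBiLipschitzPiece K (f ∘ e) (e ⁻¹' s) := by
  have hK' : (1 : ℝ) < K := by exact_mod_cast hK
  have key : ∀ x ∈ e ⁻¹' s, ∀ y ∈ e ⁻¹' s,
      ‖f (e x) - f (e y) - A (e (x - y))‖ ≤ (1 - (K : ℝ)⁻¹) * ‖x - y‖ := by
    intro x hx y hy
    have h1 := hf (e x) hx (e y) hy
    rw [← map_sub] at h1
    refine h1.trans ?_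
    calc (r : ℝ) * ‖e (x - y)‖
        ≤ r * (‖e.toContinuousLinearMap‖ * ‖x - y‖) := by
          gcongr; exact e.toContinuousLinearMap.le_opNorm _
      _ ≤ _ := by rw [← mul_assoc]; gcongr
  refine ⟨hs.preimage e.continuous.measurable, ?_, ?_, ?_⟩
  · have hb : Bornology.IsBounded (e ⁻¹' s) := by
      rw [← ContinuousLinearEquiv.image_symm_eq_preimage]
      exact e.symm.toContinuousLinearMap.lipschitz.isBounded_image hsb
    exact hb.measure_lt_top.ne
  · refine LipschitzOnWith.of_dist_le_mul fun x hx y hy => ?_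
    rw [dist_eq_norm, dist_eq_norm]
    calc ‖f (e x) - f (e y)‖
        = ‖(f (e x) - f (e y) - A (e (x - y))) + A (e (x - y))‖ := by rw [sub_add_cancel]
      _ ≤ ‖f (e x) - f (e y) - A (e (x - y))‖ + ‖A (e (x - y))‖ := norm_add_le _ _
      _ ≤ (1 - (K : ℝ)⁻¹) * ‖x - y‖ + ‖x - y‖ := by rw [he]; gcongr; exact key x hx y hy
      _ = (2 - (K : ℝ)⁻¹) * ‖x - y‖ := by ring
      _ ≤ K * ‖x - y‖ := by
        gcongr
        have : 0 ≤ ((K : ℝ) - 1) ^ 2 / K := by positivity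
        have h2 : ((K : ℝ) - 1) ^ 2 / K = K - (2 - (K : ℝ)⁻¹) := by field_simp; ring
        linarith
  · intro x hx y hy
    rw [dist_eq_norm, dist_eq_norm]
    have h1 : ‖x - y‖ ≤ (1 - (K : ℝ)⁻¹) * ‖x - y‖ + ‖f (e x) - f (e y)‖ := by
      calc ‖x - y‖ = ‖A (e (x - y))‖ := (he _).symm
        _ = ‖(f (e x) - f (e y)) - (f (e x) - f (e y) - A (e (x - y)))‖ := by rw [sub_sub_cancel]
        _ ≤ ‖f (e x) - f (e y)‖ + ‖f (e x) - f (e y) - A (e (x - y))‖ := norm_sub_le _ _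
        _ ≤ _ := by rw [add_comm]; gcongr; exact key x hx y hy
    have h2 : (K : ℝ)⁻¹ * ‖x - y‖ ≤ ‖f (e x) - f (e y)‖ := by linarith
    calc ‖x - y‖ = K * ((K : ℝ)⁻¹ * ‖x - y‖) := by field_simp
      _ ≤ _ := by gcongr; exact h2

theorem finrank_euclideanSpace_pred : finrank ℝ (EuclideanSpace ℝ (Fin (n - 1))) = n - 1 :=
  finrank_euclideanSpace_fin

/-- Almost all of a Lipschitz image is covered by countably many almost isometric pieces. -/
theorem exists_isBiLipschitzPiece_cover {K : ℝ≥0} (hK : 1 < K) {C : ℝ≥0}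
    {f : EuclideanSpace ℝ (Fin (n - 1)) → EuclideanSpace ℝ (Fin n)} (hf : LipschitzWith C f) :
    ∃ (ψ : ℕ × ℕ → EuclideanSpace ℝ (Fin (n - 1)) → EuclideanSpace ℝ (Fin n))
      (S : ℕ × ℕ → Set (EuclideanSpace ℝ (Fin (n - 1)))),
      (∀ k, IsBiLipschitzPiece K (ψ k) (S k)) ∧
        μHE[n - 1] (range f \ ⋃ k, ψ k '' S k) = 0 := by
  have hK' : (1 : ℝ) < K := by exact_mod_cast hK
  set D := {x | DifferentiableAt ℝ f x} with hD
  have hDm : MeasurableSet D := measurableSet_of_differentiableAt ℝ f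
  set s := {x | DifferentiableAt ℝ f x ∧ Function.Injective (fderiv ℝ f x)} with hs
  have hsm : MeasurableSet s :=
    hDm.inter ((measurable_fderiv ℝ f) (ContinuousLinearMap.isOpen_injective
      (𝕜 := ℝ) (E := EuclideanSpace ℝ (Fin (n - 1)))
      (F := EuclideanSpace ℝ (Fin n))).measurableSet)
  have hex : ∀ A : EuclideanSpace ℝ (Fin (n - 1)) →L[ℝ] EuclideanSpace ℝ (Fin n),
      ∃ (r : ℝ≥0) (e : EuclideanSpace ℝ (Fin (n - 1)) ≃L[ℝ] EuclideanSpace ℝ (Fin (n - 1))),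
        r ≠ 0 ∧ (Function.Injective A → (∀ x, ‖A (e x)‖ = ‖x‖) ∧
          (r : ℝ) * ‖e.toContinuousLinearMap‖ ≤ 1 - (K : ℝ)⁻¹) := by
    intro A
    by_cases hA : Function.Injective A
    · obtain ⟨e, he⟩ := exists_equiv_norm_apply_eq hA
      set N := ‖e.toContinuousLinearMap‖ with hN
      have hN0 : 0 ≤ N := norm_nonneg _
      have hpos : 0 < 1 - (K : ℝ)⁻¹ := sub_pos.2 (inv_lt_one_of_one_lt₀ hK')
      refine ⟨⟨(1 - (K : ℝ)⁻¹) / (N + 1), by positivity⟩, e, ?_, fun _ => ⟨he, ?_⟩⟩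
      · exact fun h => (div_pos hpos (by positivity : 0 < N + 1)).ne' (congrArg NNReal.toReal h)
      · calc (1 - (K : ℝ)⁻¹) / (N + 1) * N = (1 - (K : ℝ)⁻¹) * (N / (N + 1)) := by ring
          _ ≤ (1 - (K : ℝ)⁻¹) * 1 := by
            gcongr
            exact div_le_one_of_le₀ (by linarith) (by positivity)
          _ = _ := mul_one _
    · exact ⟨1, ContinuousLinearEquiv.refl ℝ _, one_ne_zero, fun h => absurd h hA⟩
  choose r e hr0 hre using hex
  obtain ⟨t, A, htm, hst, happ, hA⟩ :=
    exists_closed_cover_approximatesLinearOn_of_hasFDerivWithinAt f s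
      (fderiv ℝ f) (fun x hx => hx.1.hasFDerivAt.hasFDerivWithinAt) r hr0
  have hnull : μHE[n - 1] (f '' (D \ s)) = 0 := by
    have := euclideanHausdorffMeasure_image_of_not_injective f (s := D \ s) (fun x hx => hx.1)
      (fun x hx h => hx.2 ⟨hx.1, h⟩)
    rwa [finrank_euclideanSpace_pred] at this
  have hnull' : μHE[n - 1] (f '' Dᶜ) = 0 := by
    refine le_antisymm ((hf.lipschitzOnWith.euclideanHausdorffMeasure_image_le _).trans ?_) zero_le
    have : volume Dᶜ = 0 := ae_iff.1 (hf.ae_differentiableAt (μ := volume))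
    rw [EuclideanSpace.euclideanHausdorffMeasure_eq_volume, this, mul_zero]
  -- The first index selects the linear approximation; the second truncates to a ball, so that the
  -- piece has finite volume.
  refine ⟨fun k => f ∘ e (A k.1), fun k => e (A k.1) ⁻¹' (s ∩ t k.1 ∩ closedBall 0 k.2),
    fun k => ?_, ?_⟩
  · rcases s.eq_empty_or_nonempty with he | hne
    · simp only [he, empty_inter, preimage_empty]
      exact ⟨MeasurableSet.empty, by simp, by simp, by simp⟩
    obtain ⟨y, hy, hAy⟩ := hA hne k.1
    obtain ⟨h1, h2⟩ := hre (A k.1) (hAy ▸ hy.2)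
    exact isBiLipschitzPiece_of_approximatesLinearOn hK h1 h2
      ((hsm.inter (htm _).measurableSet).inter isClosed_closedBall.measurableSet)
      (isBounded_closedBall.subset inter_subset_right) ((happ k.1).mono_set inter_subset_left)
  · refine measure_mono_null ?_ (measure_union_null hnull hnull')
    rintro _ ⟨⟨x, rfl⟩, hx⟩
    by_cases hxD : x ∈ D
    · refine Or.inl ⟨x, ⟨hxD, fun hxs => hx ?_⟩, rfl⟩
      obtain ⟨i, hi⟩ := mem_iUnion.1 (hst hxs)
      obtain ⟨j, hj⟩ := exists_nat_ge ‖x‖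
      refine mem_iUnion.2 ⟨(i, j), (e (A i)).symm x, ?_, by simp⟩
      simpa using ⟨⟨hxs, hi⟩, hj⟩
    · exact Or.inr ⟨x, hxD, rfl⟩

/-! ### Rectifiable sets have density one almost everywhere. -/

theorem hausdorffOuter_eq (S : Set (EuclideanSpace ℝ (Fin n))) :
    hausdorffOuter n S = μHE[n - 1] S := rfl

theorem densityRatio_le_add {A B C : Set (EuclideanSpace ℝ (Fin n))} (h : A ⊆ B ∪ C)
    (x : EuclideanSpace ℝ (Fin n)) (r : ℝ) :
    densityRatio A x r ≤ densityRatio B x r + densityRatio C x r := by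
  simp only [densityRatio]
  rw [← ENNReal.add_div]
  refine ENNReal.div_le_div_right ((measure_mono ?_).trans (measure_union_le _ _)) _
  rw [← union_inter_distrib_right]
  exact inter_subset_inter_left _ h

theorem densityRatio_eq_zero {A : Set (EuclideanSpace ℝ (Fin n))} (h : μHE[n - 1] A = 0)
    (x : EuclideanSpace ℝ (Fin n)) (r : ℝ) : densityRatio A x r = 0 := by
  rw [densityRatio, hausdorffOuter_eq, measure_mono_null inter_subset_left h, ENNReal.zero_div]

theorem densityRatio_congr {A B : Set (EuclideanSpace ℝ (Fin n))} (h : μHE[n - 1] (A \ B) = 0)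
    (h' : μHE[n - 1] (B \ A) = 0) (x : EuclideanSpace ℝ (Fin n)) (r : ℝ) :
    densityRatio A x r = densityRatio B x r := by
  refine le_antisymm ?_ ?_
  · refine (densityRatio_le_add (B := B) (C := A \ B) (by simp) x r).trans ?_
    rw [densityRatio_eq_zero h, add_zero]
  · refine (densityRatio_le_add (B := A) (C := B \ A) (by simp) x r).trans ?_
    rw [densityRatio_eq_zero h', add_zero]

theorem HasDensity.congr {A B : Set (EuclideanSpace ℝ (Fin n))} (h : μHE[n - 1] (A \ B) = 0)
    (h' : μHE[n - 1] (B \ A) = 0) {x : EuclideanSpace ℝ (Fin n)} {c : ℝ≥0∞}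
    (hA : HasDensity A x c) : HasDensity B x c :=
  Tendsto.congr (densityRatio_congr h h' x) hA

/-- Up to factors close to `1`, the density of a set that is almost covered by almost isometric
pieces is `1`. -/
theorem ae_densityRatio_bounds {E : Set (EuclideanSpace ℝ (Fin n))} (hE : MeasurableSet E)
    (hfin : μHE[n - 1] E ≠ ∞) (hrect : IsCountablyRectifiable E) {K : ℝ≥0} (hK : 1 < K) :
    ∀ᵐ x ∂(μHE[n - 1] : Measure (EuclideanSpace ℝ (Fin n))), x ∈ E →
      (∀ a > (K : ℝ≥0∞) ^ (2 * (n - 1)), ∀ᶠ r in 𝓝[>] (0 : ℝ), densityRatio E x r < a) ∧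
      (∀ a < ((K : ℝ≥0∞) ^ (2 * (n - 1) + 1))⁻¹,
        ∀ᶠ r in 𝓝[>] (0 : ℝ), a < densityRatio E x r) := by
  obtain ⟨f, hf, hf0⟩ := hrect
  choose C hC using hf
  choose ψ S hψ hψ0 using fun k => exists_isBiLipschitzPiece_cover hK (hC k)
  have h1 : ∀ᵐ x ∂(μHE[n - 1] : Measure (EuclideanSpace ℝ (Fin n))), ∀ k j,
      (x ∈ ψ k j '' S k j → ∀ᶠ r in 𝓝[>] (0 : ℝ),
        ((K : ℝ≥0∞) ^ (2 * (n - 1) + 1))⁻¹ ≤ densityRatio (ψ k j '' S k j) x r) ∧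
      (x ∉ E \ ψ k j '' S k j → HasDensity (E \ ψ k j '' S k j) x 0) ∧
      (x ∉ ψ k j '' S k j \ E → HasDensity (ψ k j '' S k j \ E) x 0) := by
    refine ae_all_iff.2 fun k => ae_all_iff.2 fun j => ?_
    have hm := (hψ k j).measurableSet_image
    filter_upwards [ae_le_densityRatio_image (hψ k j).measurableSet hK (hψ k j).lipschitzOnWith
        (hψ k j).dist_le,
      ae_hasDensity_zero (hE.diff hm) (measure_ne_top_of_subset sdiff_subset hfin),
      ae_hasDensity_zero (hm.diff hE) (measure_ne_top_of_subset sdiff_subset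
        (hψ k j).image_ne_top)] with x h1 h2 h3 using ⟨h1, h2, h3⟩
  have h2 : ∀ᵐ x ∂(μHE[n - 1] : Measure (EuclideanSpace ℝ (Fin n))),
      x ∉ E \ ⋃ k, range (f k) := measure_eq_zero_iff_ae_notMem.1 hf0
  have h3 : ∀ᵐ x ∂(μHE[n - 1] : Measure (EuclideanSpace ℝ (Fin n))), ∀ k,
      x ∉ range (f k) \ ⋃ j, ψ k j '' S k j :=
    ae_all_iff.2 fun k => measure_eq_zero_iff_ae_notMem.1 (hψ0 k)
  filter_upwards [h1, h2, h3] with x hx1 hx2 hx3 hxE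
  obtain ⟨k, hk⟩ : ∃ k, x ∈ range (f k) := by
    by_contra h
    exact hx2 ⟨hxE, fun h' => h (mem_iUnion.1 h')⟩
  obtain ⟨j, hj⟩ : ∃ j, x ∈ ψ k j '' S k j := by
    by_contra h
    exact hx3 k ⟨hk, fun h' => h (mem_iUnion.1 h')⟩
  -- Near `x` the set `E` and the piece differ by two sets of density zero, so the bounds for the
  -- piece pass to `E`.
  obtain ⟨hlow, hz1, hz2⟩ := hx1 k j
  replace hlow := hlow hj
  replace hz1 : Tendsto _ _ _ := hz1 fun h => h.2 hj
  replace hz2 : Tendsto _ _ _ := hz2 fun h => h.2 hxE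
  refine ⟨fun a ha => ?_, fun a ha => ?_⟩
  · have hlim := hz1.const_add ((K : ℝ≥0∞) ^ (2 * (n - 1)))
    rw [add_zero] at hlim
    filter_upwards [hlim.eventually (gt_mem_nhds ha), self_mem_nhdsWithin] with r hr hr0
    refine lt_of_le_of_lt ?_ hr
    refine (densityRatio_le_add (B := ψ k j '' S k j) (C := E \ ψ k j '' S k j) (by simp)
      x r).trans ?_
    gcongr
    exact densityRatio_image_le (hψ k j).lipschitzOnWith (hψ k j).dist_le hj hr0
  · have hlim := ENNReal.Tendsto.sub
      (tendsto_const_nhds (x := ((K : ℝ≥0∞) ^ (2 * (n - 1) + 1))⁻¹)) hz2 (Or.inr (by simp))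
    rw [tsub_zero] at hlim
    filter_upwards [hlim.eventually (lt_mem_nhds ha), hlow] with r hr hr1
    refine hr.trans_le (tsub_le_iff_right.2 (hr1.trans ?_))
    exact densityRatio_le_add (by simp) x r

/-- The density of a rectifiable set is `1` at almost all of its points. -/
theorem ae_hasDensity_one {E : Set (EuclideanSpace ℝ (Fin n))} (hE : MeasurableSet E)
    (hfin : μHE[n - 1] E ≠ ∞) (hrect : IsCountablyRectifiable E) :
    ∀ᵐ x ∂(μHE[n - 1] : Measure (EuclideanSpace ℝ (Fin n))), x ∈ E → HasDensity E x 1 := by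
  -- Countably many constants `K = 1 + 1 / (j + 1)` suffice to squeeze the density to `1`.
  have hu : Tendsto (fun j : ℕ => (1 : ℝ≥0) + 1 / ((j : ℝ≥0) + 1)) atTop (𝓝 1) := by
    have := (tendsto_one_div_add_atTop_nhds_zero_nat (𝕜 := ℝ≥0)).const_add 1
    rwa [add_zero] at this
  have hpow : ∀ N : ℕ, Tendsto (fun j : ℕ => (((1 : ℝ≥0) + 1 / ((j : ℝ≥0) + 1) : ℝ≥0) : ℝ≥0∞) ^ N)
      atTop (𝓝 1) := by
    intro N
    have := ((ENNReal.continuous_pow N).tendsto _).comp (ENNReal.tendsto_coe.2 hu)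
    rw [ENNReal.coe_one, one_pow] at this
    exact this
  have hinv : Tendsto (fun j : ℕ => ((((1 : ℝ≥0) + 1 / ((j : ℝ≥0) + 1) : ℝ≥0) : ℝ≥0∞) ^
      (2 * (n - 1) + 1))⁻¹) atTop (𝓝 1) := by
    simpa only [inv_one] using tendsto_inv_iff.2 (hpow (2 * (n - 1) + 1))
  filter_upwards [ae_all_iff.2 fun j : ℕ => ae_densityRatio_bounds hE hfin hrect
    (K := (1 : ℝ≥0) + 1 / ((j : ℝ≥0) + 1)) (lt_add_of_pos_right _ (by positivity))] with x hx hxE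
  refine tendsto_order.2 ⟨fun a ha => ?_, fun a ha => ?_⟩
  · obtain ⟨j, hj⟩ := (hinv.eventually (lt_mem_nhds ha)).exists
    exact (hx j hxE).2 a hj
  · obtain ⟨j, hj⟩ := ((hpow (2 * (n - 1))).eventually (gt_mem_nhds ha)).exists
    exact (hx j hxE).1 a hj

/-! ### Borel measurability of density sets, and normalization of rectifiable sets. -/

/-- Closed balls decrease to the closed ball as the radius decreases. This right continuity reduces
density limits to rational radii. -/
theorem tendsto_densityRatio_nhdsGT {E : Set (EuclideanSpace ℝ (Fin n))} (hE : MeasurableSet E)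
    (hfin : μHE[n - 1] E ≠ ∞) (x : EuclideanSpace ℝ (Fin n)) {r : ℝ} (hr : 0 < r) :
    Tendsto (densityRatio E x) (𝓝[>] r) (𝓝 (densityRatio E x r)) := by
  refine ENNReal.Tendsto.div ?_ (Or.inr (densityDenominator_ne_zero _ hr)) ?_
    (Or.inl (densityDenominator_ne_top _ _))
  · have h := tendsto_measure_biInter_gt (μ := (μHE[n - 1] : Measure (EuclideanSpace ℝ (Fin n))))
      (s := fun r => E ∩ closedBall x r) (a := r)
      (fun s _ => (hE.inter isClosed_closedBall.measurableSet).nullMeasurableSet)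
      (fun s t _ hst => inter_subset_inter_right _ (closedBall_subset_closedBall hst))
      ⟨r + 1, by simp, measure_ne_top_of_subset inter_subset_left hfin⟩
    have h2 : ⋂ s > r, E ∩ closedBall x s = E ∩ closedBall x r := by
      ext y
      simp only [mem_iInter, mem_inter_iff, mem_closedBall]
      refine ⟨fun h => ⟨(h (r + 1) (by simp)).1, le_of_forall_gt_imp_ge_of_dense
        fun s hs => (h s hs).2⟩, fun h s hs => ⟨h.1, h.2.trans (le_of_lt hs)⟩⟩
    rw [h2] at h
    exact h
  · refine ENNReal.Tendsto.const_mul (Tendsto.mono_left ?_ nhdsWithin_le_nhds)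
      (Or.inr (volume_closedBall_zero_one_ne_top _))
    exact ((ENNReal.continuous_pow _).comp ENNReal.continuous_ofReal).tendsto r

theorem comap_ratCast_nhdsGT_neBot (r : ℝ) : (comap ((↑) : ℚ → ℝ) (𝓝[>] r)).NeBot := by
  refine comap_neBot fun t ht => ?_
  obtain ⟨u, hu, hut⟩ := (mem_nhdsGT_iff_exists_Ioo_subset).1 ht
  obtain ⟨q, hq1, hq2⟩ := exists_rat_btwn (mem_Ioi.1 hu)
  exact ⟨q, hut ⟨hq1, hq2⟩⟩

theorem hasDensity_iff_tendsto_rat {E : Set (EuclideanSpace ℝ (Fin n))} (hE : MeasurableSet E)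
    (hfin : μHE[n - 1] E ≠ ∞) (x : EuclideanSpace ℝ (Fin n)) (c : ℝ≥0∞) :
    HasDensity E x c ↔
      Tendsto (fun q : ℚ => densityRatio E x q) (comap (↑) (𝓝[>] (0 : ℝ))) (𝓝 c) := by
  refine ⟨fun h => h.comp tendsto_comap, fun h => ?_⟩
  refine (closed_nhds_basis c).tendsto_right_iff.2 fun s hs => ?_
  obtain ⟨t, ht, hts⟩ := mem_comap.1 (h hs.1)
  obtain ⟨u, hu, hut⟩ := (mem_nhdsGT_iff_exists_Ioo_subset).1 ht
  filter_upwards [Ioo_mem_nhdsGT (mem_Ioi.1 hu)] with r hr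
  have := comap_ratCast_nhdsGT_neBot r
  have hlim : Tendsto (fun q : ℚ => densityRatio E x q) (comap (↑) (𝓝[>] r))
      (𝓝 (densityRatio E x r)) :=
    (tendsto_densityRatio_nhdsGT hE hfin x hr.1).comp tendsto_comap
  refine hs.2.mem_of_tendsto hlim ?_
  filter_upwards [preimage_mem_comap (Ioo_mem_nhdsGT hr.2)] with q hq
  exact hts (hut ⟨hr.1.trans hq.1, hq.2⟩)

/-- Only countably many radii matter, and for a fixed radius the ratio is measurable in the centre,
being the measure of a section of a closed set in the product. -/
theorem measurableSet_hasDensity {E : Set (EuclideanSpace ℝ (Fin n))} (hE : MeasurableSet E)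
    (hfin : μHE[n - 1] E ≠ ∞) (c : ℝ≥0∞) : MeasurableSet {x | HasDensity E x c} := by
  simp_rw [hasDensity_iff_tendsto_rat hE hfin]
  refine measurableSet_tendsto (𝓝 c) fun q => ?_
  refine Measurable.div_const ?_ _
  have hμ : IsFiniteMeasure ((μHE[n - 1] : Measure (EuclideanSpace ℝ (Fin n))).restrict E) :=
    ⟨by simpa using hfin.lt_top⟩
  have hs : MeasurableSet {p : EuclideanSpace ℝ (Fin n) × EuclideanSpace ℝ (Fin n) |
      dist p.2 p.1 ≤ q} := measurableSet_le (by fun_prop) measurable_const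
  have := measurable_measure_prodMk_left
    (ν := (μHE[n - 1] : Measure (EuclideanSpace ℝ (Fin n))).restrict E) hs
  convert this using 2 with x
  rw [show Prod.mk x ⁻¹' {p : EuclideanSpace ℝ (Fin n) × EuclideanSpace ℝ (Fin n) |
      dist p.2 p.1 ≤ q} = closedBall x q from rfl,
    Measure.restrict_apply isClosed_closedBall.measurableSet, inter_comm]
  rfl

/-- The Carathéodory condition is tested on a measurable hull of `S`; finiteness allows cancelling
the measure of `S`. -/
theorem nullMeasurableSet_of_isCaratheodory {S : Set (EuclideanSpace ℝ (Fin n))}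
    (hS : (hausdorffOuter n).IsCaratheodory S) (hfin : μHE[n - 1] S ≠ ∞) :
    NullMeasurableSet S (μHE[n - 1] : Measure (EuclideanSpace ℝ (Fin n))) := by
  set H : Measure (EuclideanSpace ℝ (Fin n)) := μHE[n - 1]
  have h : H (toMeasurable H S) = H (toMeasurable H S ∩ S) + H (toMeasurable H S \ S) := hS _
  rw [inter_eq_right.2 (subset_toMeasurable H S), measure_toMeasurable] at h
  have h0 : H (toMeasurable H S \ S) = 0 := by
    have : H S + 0 = H S + H (toMeasurable H S \ S) := by rw [add_zero]; exact h
    exact ((ENNReal.add_right_inj hfin).1 this).symm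
  refine ((measurableSet_toMeasurable H S).nullMeasurableSet).congr ?_
  exact (LE.le.eventuallyLE (subset_toMeasurable H S)).antisymm
    (ae_le_set.2 h0) |>.symm

theorem isCaratheodory_of_nullMeasurableSet {S : Set (EuclideanSpace ℝ (Fin n))}
    (hS : NullMeasurableSet S (μHE[n - 1] : Measure (EuclideanSpace ℝ (Fin n)))) :
    (hausdorffOuter n).IsCaratheodory S := fun t =>
  (measure_inter_add_sdiff₀ t hS).symm

theorem IsRectifiable.of_measure_diff_eq_zero {E F : Set (EuclideanSpace ℝ (Fin n))}
    (hE : IsRectifiable E)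
    (hF : NullMeasurableSet F (μHE[n - 1] : Measure (EuclideanSpace ℝ (Fin n))))
    (h : μHE[n - 1] (F \ E) = 0) : IsRectifiable F where
  isCaratheodory := isCaratheodory_of_nullMeasurableSet hF
  lt_top := by
    have : F ⊆ E ∪ F \ E := by simp
    refine ((measure_mono this).trans (measure_union_le _ _)).trans_lt ?_
    rw [hausdorffOuter_eq (F \ E), h, add_zero]
    exact hE.lt_top
  countablyRectifiable := by
    obtain ⟨f, hf, hf0⟩ := hE.countablyRectifiable
    refine ⟨f, hf, measure_mono_null ?_ (measure_union_null h hf0)⟩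
    rintro x ⟨hx, hx'⟩
    by_cases hxE : x ∈ E
    exacts [Or.inr ⟨hxE, hx'⟩, Or.inl ⟨hx, hxE⟩]

/-- Every rectifiable subset of `Ω` agrees almost everywhere with a member of `ℰ`. -/
theorem exists_normalized {Ω : Set (EuclideanSpace ℝ (Fin n))} (hΩ : IsOpen Ω)
    {E : Set (EuclideanSpace ℝ (Fin n))} (hEΩ : E ⊆ Ω) (hE : IsRectifiable E) :
    ∃ F : Normalized Ω, μHE[n - 1] (E \ F.1) = 0 ∧ μHE[n - 1] (F.1 \ E) = 0 := by
  obtain ⟨E₀, hE₀E, hE₀, hae⟩ := (nullMeasurableSet_of_isCaratheodory hE.isCaratheodory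
    hE.lt_top.ne).exists_measurable_subset_ae_eq
  have hfin : μHE[n - 1] E₀ ≠ ∞ := measure_ne_top_of_subset hE₀E hE.lt_top.ne
  have hd1 : μHE[n - 1] (E₀ \ E) = 0 := by rw [sdiff_eq_empty.2 hE₀E, measure_empty]
  have hd2 : μHE[n - 1] (E \ E₀) = 0 := ae_le_set.1 hae.symm.le
  have hrect : IsRectifiable E₀ := hE.of_measure_diff_eq_zero hE₀.nullMeasurableSet hd1
  -- `F` differs from `E₀` by a null set, so both have the same densities at every point; hence `F`
  -- is its own set of density-one points in `Ω`.
  set F := Ω ∩ {x | HasDensity E₀ x 1} with hF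
  have hFm : MeasurableSet F := hΩ.measurableSet.inter (measurableSet_hasDensity hE₀ hfin 1)
  have hEF : μHE[n - 1] (E₀ \ F) = 0 := by
    refine measure_mono_null ?_ (ae_iff.1 (ae_hasDensity_one hE₀ hfin hrect.countablyRectifiable))
    rintro x ⟨hx, hx'⟩ h
    exact hx' ⟨hEΩ (hE₀E hx), h hx⟩
  have hFE : μHE[n - 1] (F \ E₀) = 0 := by
    refine measure_mono_null ?_ (ae_iff.1 (ae_hasDensity_zero hE₀ hfin))
    rintro x ⟨hx, hx'⟩ h
    exact zero_ne_one (tendsto_nhds_unique (h hx') hx.2)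
  refine ⟨⟨F, inter_subset_left, hFm, hrect.of_measure_diff_eq_zero hFm.nullMeasurableSet hFE,
    fun x hx => ⟨fun h => h.2.congr hEF hFE, fun h => ⟨hx, h.congr hFE hEF⟩⟩⟩, ?_, ?_⟩
  · refine measure_mono_null ?_ (measure_union_null hd2 hEF)
    rintro x ⟨hx, hx'⟩
    by_cases h : x ∈ E₀
    exacts [Or.inr ⟨h, hx'⟩, Or.inl ⟨hx, h⟩]
  · exact measure_mono_null (sdiff_subset_sdiff_right hE₀E) hFE

/-! ### Germs at common points, and the fiber measure as a directed supremum. -/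

variable {Ω : Set (EuclideanSpace ℝ (Fin n))}

/-- Since `E` is almost contained in `F`, the ratio of `F \ E` is the difference of the two ratios,
which tends to `1 - 1`. -/
theorem hasDensity_diff_zero {E F : Set (EuclideanSpace ℝ (Fin n))} (hE : MeasurableSet E)
    (hEF : μHE[n - 1] (E \ F) = 0) {x : EuclideanSpace ℝ (Fin n)} (hEx : HasDensity E x 1)
    (hFx : HasDensity F x 1) : HasDensity (F \ E) x 0 := by
  have hadd : ∀ r, densityRatio F x r = densityRatio (F \ E) x r + densityRatio E x r := by
    intro r
    have h1 : densityRatio (F ∩ E) x r = densityRatio E x r :=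
      densityRatio_congr (by rw [sdiff_eq_empty.2 inter_subset_right, measure_empty])
        (by rwa [sdiff_inter_self_eq_sdiff]) x r
    rw [← h1, densityRatio, densityRatio, densityRatio, ← ENNReal.add_div]
    congr 1
    simp only [hausdorffOuter_eq]
    rw [add_comm, ← measure_inter_add_sdiff (F ∩ closedBall x r) hE]
    congr 2
    · ext y; simp only [mem_inter_iff]; tauto
    · ext y; simp only [mem_inter_iff, Set.mem_sdiff]; tauto
  have hlim : Tendsto (fun r => densityRatio F x r - densityRatio E x r) (𝓝[>] 0) (𝓝 (1 - 1)) :=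
    ENNReal.Tendsto.sub hFx hEx (Or.inl ENNReal.one_ne_top)
  rw [tsub_self] at hlim
  refine hlim.congr' ?_
  filter_upwards [hEx.eventually (gt_mem_nhds ENNReal.one_lt_top)] with r hr
  rw [hadd r, ENNReal.add_sub_cancel_right hr.ne]

theorem Normalized.hasDensity (E : Normalized Ω) {x : EuclideanSpace ℝ (Fin n)} (hx : x ∈ E.1) :
    HasDensity E.1 x 1 :=
  (E.2.mem_iff x (E.2.subset hx)).1 hx

theorem Normalized.measure_ne_top (E : Normalized Ω) : μHE[n - 1] E.1 ≠ ∞ :=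
  E.2.rectifiable.lt_top.ne

/-- Almost inclusion of members of `ℰ` induces an equality of germs at the common points. -/
theorem germMap_eq_germMap {E F : Normalized Ω} (hEF : μHE[n - 1] (E.1 \ F.1) = 0)
    {x : EuclideanSpace ℝ (Fin n)} (hE : x ∈ E.1) (hF : x ∈ F.1) :
    germMap E ⟨x, hE⟩ = germMap F ⟨x, hF⟩ := by
  have h0 : HasDensity (E.1 \ F.1) x 0 :=
    tendsto_const_nhds.congr fun r => (densityRatio_eq_zero hEF x r).symm
  have h : HasDensity (E.1 ∆ F.1) x 0 := h0.zero_of_subset_union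
    (hasDensity_diff_zero E.2.measurableSet hEF (E.hasDensity hE) (F.hasDensity hF)) subset_rfl
  have hq : Quotient.mk (germSetoid Ω x) ⟨E.1, E.2, hE⟩ =
      Quotient.mk (germSetoid Ω x) ⟨F.1, F.2, hF⟩ := Quotient.sound h
  simp only [germMap]
  rw [hq]

theorem mem_germPreimage {E : Normalized Ω} {A : Set (FiberSpace Ω)}
    {x : EuclideanSpace ℝ (Fin n)} :
    x ∈ germPreimage E A ↔ ∃ h : x ∈ E.1, germMap E ⟨x, h⟩ ∈ A := by
  simp [germPreimage]

theorem germPreimage_subset (E : Normalized Ω) (A : Set (FiberSpace Ω)) :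
    germPreimage E A ⊆ E.1 := fun _ hx => (mem_germPreimage.1 hx).1

theorem germPreimage_ne_top (E : Normalized Ω) (A : Set (FiberSpace Ω)) :
    μHE[n - 1] (germPreimage E A) ≠ ∞ :=
  measure_ne_top_of_subset (germPreimage_subset E A) E.measure_ne_top

theorem germPreimage_inter_eq {E F : Normalized Ω} (hEF : μHE[n - 1] (E.1 \ F.1) = 0)
    (A : Set (FiberSpace Ω)) : germPreimage E A ∩ F.1 = germPreimage F A ∩ E.1 := by
  ext x
  simp only [mem_inter_iff, mem_germPreimage]
  refine ⟨fun ⟨⟨hE, h⟩, hF⟩ => ⟨⟨hF, ?_⟩, hE⟩, fun ⟨⟨hF, h⟩, hE⟩ => ⟨⟨hE, ?_⟩, hF⟩⟩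
  · rwa [← germMap_eq_germMap hEF hE hF]
  · rwa [germMap_eq_germMap hEF hE hF]

theorem germMeasure_apply' (E : Normalized Ω) {A : Set (FiberSpace Ω)} (hA : MeasurableSet A) :
    germMeasure E A = μHE[n - 1] (germPreimage E A) := germMeasure_apply E hA

theorem germMeasure_mono {E F : Normalized Ω} (hEF : μHE[n - 1] (E.1 \ F.1) = 0) :
    germMeasure E ≤ germMeasure F := by
  refine Measure.le_iff.2 fun A hA => ?_
  rw [germMeasure_apply' E hA, germMeasure_apply' F hA]
  have : germPreimage E A ⊆ germPreimage F A ∪ E.1 \ F.1 := by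
    intro x hx
    by_cases hF : x ∈ F.1
    · exact Or.inl ((germPreimage_inter_eq hEF A).subset ⟨hx, hF⟩).1
    · exact Or.inr ⟨germPreimage_subset E A hx, hF⟩
  refine (measure_mono this).trans ((measure_union_le _ _).trans ?_)
  rw [hEF, add_zero]

theorem exists_normalized_upperBound (hΩ : IsOpen Ω) (E F : Normalized Ω) :
    ∃ G : Normalized Ω, μHE[n - 1] (E.1 \ G.1) = 0 ∧ μHE[n - 1] (F.1 \ G.1) = 0 := by
  obtain ⟨G, hG, -⟩ := exists_normalized hΩ (union_subset E.2.subset F.2.subset)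
    (E.2.rectifiable.union F.2.rectifiable)
  exact ⟨G, measure_mono_null (sdiff_subset_sdiff_left subset_union_left) hG,
    measure_mono_null (sdiff_subset_sdiff_left subset_union_right) hG⟩

/-- The least upper bound of a directed family of measures is computed setwise. -/
theorem _root_.MeasureTheory.Measure.iSup_apply_of_directed {α ι : Type*} [MeasurableSpace α]
    [Nonempty ι] {μ : ι → Measure α} (hμ : Directed (· ≤ ·) μ) {s : Set α}
    (hs : MeasurableSet s) : (⨆ i, μ i) s = ⨆ i, μ i s := by
  let ν : Measure α := Measure.ofMeasurable (fun s _ => ⨆ i, μ i s) (by simp) (by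
    intro f hf hd
    simp_rw [measure_iUnion hd hf, ENNReal.tsum_eq_iSup_sum]
    rw [iSup_comm]
    congr 1
    funext t
    -- Directedness lets the supremum pass through finite sums, which yields countable additivity.
    refine (ENNReal.finsetSum_iSup fun i j => ?_).symm
    obtain ⟨k, hik, hjk⟩ := hμ i j
    exact ⟨k, fun a => ⟨hik _, hjk _⟩⟩)
  have hν : ∀ t, MeasurableSet t → ν t = ⨆ i, μ i t := fun t ht =>
    Measure.ofMeasurable_apply t ht
  refine le_antisymm ?_ (iSup_le fun i => le_iSup μ i s)
  rw [← hν s hs]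
  refine (iSup_le fun i => Measure.le_iff.2 fun t ht => ?_ : ⨆ i, μ i ≤ ν) s
  rw [hν t ht]
  exact le_iSup (fun i => μ i t) i

theorem nonempty_normalized (hΩ : IsOpen Ω) : Nonempty (Normalized Ω) :=
  let ⟨F, _⟩ := exists_normalized hΩ (empty_subset Ω) IsRectifiable.empty
  ⟨F⟩

theorem fiberMeasure_apply (hΩ : IsOpen Ω) {A : Set (FiberSpace Ω)} (hA : MeasurableSet A) :
    fiberMeasure Ω A = ⨆ E : Normalized Ω, μHE[n - 1] (germPreimage E A) := by
  have := nonempty_normalized hΩ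
  have hdir : Directed (· ≤ ·) (fun E : Normalized Ω => germMeasure E) := fun E F =>
    let ⟨G, hEG, hFG⟩ := exists_normalized_upperBound hΩ E F
    ⟨G, germMeasure_mono hEG, germMeasure_mono hFG⟩
  rw [fiberMeasure, Measure.iSup_apply_of_directed hdir hA]
  exact iSup_congr fun E => germMeasure_apply' E hA

/-! ### The projection and the parts of the fiber space over members of `ℰ`. -/

theorem germPreimage_proj_preimage (E : Normalized Ω) (S : Set Ω) :
    germPreimage E (proj ⁻¹' S) = Subtype.val '' S ∩ E.1 := by
  ext x
  simp only [mem_germPreimage, mem_inter_iff]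
  constructor
  · rintro ⟨hE, hx⟩
    exact ⟨⟨_, hx, rfl⟩, hE⟩
  · rintro ⟨⟨y, hy, rfl⟩, hE⟩
    exact ⟨hE, hy⟩

theorem measurableSet_image_val (hΩ : IsOpen Ω) {S : Set Ω} (hS : MeasurableSet S) :
    MeasurableSet (Subtype.val '' S : Set (EuclideanSpace ℝ (Fin n))) :=
  hΩ.measurableSet.subtype_image hS

theorem measurable_proj (hΩ : IsOpen Ω) : Measurable (proj : FiberSpace Ω → Ω) := by
  intro S hS E
  rw [germPreimage_proj_preimage]
  exact isCaratheodory_of_nullMeasurableSet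
    ((measurableSet_image_val hΩ hS).inter E.2.measurableSet).nullMeasurableSet

/-- The suprema over `ℰ` and over all rectifiable sets coincide, because each rectifiable set agrees
almost everywhere with a member of `ℰ`. -/
theorem measurePreserving_proj (hΩ : IsOpen Ω) :
    MeasurePreserving (proj : FiberSpace Ω → Ω) (fiberMeasure Ω) (rectMeasure Ω) := by
  refine ⟨measurable_proj hΩ, Measure.ext fun S hS => ?_⟩
  rw [Measure.map_apply (measurable_proj hΩ) hS, fiberMeasure_apply hΩ (measurable_proj hΩ hS),
    rectMeasure_apply Ω hS]
  simp_rw [germPreimage_proj_preimage]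
  refine le_antisymm (iSup_le fun E => le_iSup_of_le ⟨E.1, E.2.subset, E.2.rectifiable⟩ le_rfl)
    (iSup_le fun E => ?_)
  obtain ⟨F, hF, -⟩ := exists_normalized hΩ E.2.1 E.2.2
  refine le_iSup_of_le F ?_
  have : Subtype.val '' S ∩ E.1 ⊆ Subtype.val '' S ∩ F.1 ∪ E.1 \ F.1 := by
    rintro x ⟨hx, hE⟩
    by_cases h : x ∈ F.1
    exacts [Or.inl ⟨hx, h⟩, Or.inr ⟨hE, h⟩]
  refine (measure_mono this).trans ((measure_union_le _ _).trans ?_)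
  rw [hausdorffOuter_eq (E.1 \ F.1), hF, add_zero]
  rfl

/-- Over `E` the fiber measure sees only the section of `E`: any competitor `F` is dominated by some
`G` almost containing both, and at points of `E` the germs of `G` are those of `E`. -/
theorem fiberMeasure_apply_of_subset (hΩ : IsOpen Ω) (E : Normalized Ω) {A : Set (FiberSpace Ω)}
    (hA : MeasurableSet A) (hAE : A ⊆ proj ⁻¹' (Subtype.val ⁻¹' E.1)) :
    fiberMeasure Ω A = μHE[n - 1] (germPreimage E A) := by
  rw [fiberMeasure_apply hΩ hA]
  refine le_antisymm (iSup_le fun F => ?_) (le_iSup (fun E : Normalized Ω =>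
    μHE[n - 1] (germPreimage E A)) E)
  obtain ⟨G, hFG, hEG⟩ := exists_normalized_upperBound hΩ F E
  calc μHE[n - 1] (germPreimage F A) ≤ μHE[n - 1] (germPreimage G A) := by
        rw [← germMeasure_apply' F hA, ← germMeasure_apply' G hA]
        exact germMeasure_mono hFG A
    _ ≤ _ := by
        refine measure_mono fun x hx => ?_
        have hxE : x ∈ E.1 := by
          obtain ⟨hG, h⟩ := mem_germPreimage.1 hx
          exact hAE h
        exact ((germPreimage_inter_eq hEG A).symm.subset ⟨hx, hxE⟩).1

theorem rectMeasure_apply_of_subset {E : Set (EuclideanSpace ℝ (Fin n))} (hEΩ : E ⊆ Ω)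
    (hE : IsRectifiable E) {S : Set Ω} (hS : MeasurableSet S) (hSE : Subtype.val '' S ⊆ E) :
    rectMeasure Ω S = μHE[n - 1] (Subtype.val '' S) := by
  rw [rectMeasure_apply Ω hS]
  refine le_antisymm (iSup_le fun F => measure_mono inter_subset_left) ?_
  refine le_iSup_of_le ⟨E, hEΩ, hE⟩ ?_
  rw [inter_eq_left.2 hSE]
  rfl

theorem rectMeasure_preimage_inter (E : Normalized Ω) {B : Set (EuclideanSpace ℝ (Fin n))}
    (hB : MeasurableSet B) :
    rectMeasure Ω (Subtype.val ⁻¹' (E.1 ∩ B)) = μHE[n - 1] (E.1 ∩ B) := by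
  have h : Subtype.val '' (Subtype.val ⁻¹' (E.1 ∩ B) : Set Ω) = E.1 ∩ B := by
    rw [Subtype.image_preimage_coe, inter_eq_right.2 (inter_subset_left.trans E.2.subset)]
  rw [rectMeasure_apply_of_subset E.2.subset E.2.rectifiable
    ((E.2.measurableSet.inter hB).preimage measurable_subtype_coe) (by rw [h]; exact inter_subset_left),
    h]

theorem rectMeasure_preimage_inter_ne_top (E : Normalized Ω)
    {B : Set (EuclideanSpace ℝ (Fin n))} (hB : MeasurableSet B) :
    rectMeasure Ω (Subtype.val ⁻¹' (E.1 ∩ B)) ≠ ∞ := by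
  rw [rectMeasure_preimage_inter E hB]
  exact measure_ne_top_of_subset inter_subset_left E.measure_ne_top

theorem map_val_restrict_rectMeasure (E : Normalized Ω) :
    ((rectMeasure Ω).restrict (Subtype.val ⁻¹' E.1)).map Subtype.val =
      (μHE[n - 1] : Measure (EuclideanSpace ℝ (Fin n))).restrict E.1 := by
  refine Measure.ext fun B hB => ?_
  rw [Measure.map_apply measurable_subtype_coe hB,
    Measure.restrict_apply (hB.preimage measurable_subtype_coe), Measure.restrict_apply hB,
    ← preimage_inter, inter_comm B, rectMeasure_preimage_inter E hB]

/-- Sets of finite `ℐ^{n-1}`-measure are exhausted, up to small measure, by members of `ℰ`. -/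
theorem exists_normalized_rectMeasure_diff_lt (hΩ : IsOpen Ω) {S : Set Ω} (hS : MeasurableSet S)
    (hfin : rectMeasure Ω S ≠ ∞) {ε : ℝ≥0∞} (hε : ε ≠ 0) :
    ∃ E : Normalized Ω, rectMeasure Ω (S \ Subtype.val ⁻¹' E.1) < ε := by
  rcases eq_or_ne (rectMeasure Ω S) 0 with h0 | h0
  · obtain ⟨E⟩ := nonempty_normalized hΩ
    exact ⟨E, (measure_mono_null sdiff_subset h0).trans_lt (pos_iff_ne_zero.2 hε)⟩
  have hlt : rectMeasure Ω S - ε < rectMeasure Ω S := ENNReal.sub_lt_self hfin h0 hε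
  rw [← (measurePreserving_proj hΩ).measure_preimage hS.nullMeasurableSet] at hlt
  conv_rhs at hlt => rw [fiberMeasure_apply hΩ (measurable_proj hΩ hS)]
  rw [(measurePreserving_proj hΩ).measure_preimage hS.nullMeasurableSet] at hlt
  obtain ⟨E, hE⟩ := lt_iSup_iff.1 hlt
  refine ⟨E, ?_⟩
  have hEm : MeasurableSet (Subtype.val ⁻¹' E.1 : Set Ω) :=
    E.2.measurableSet.preimage measurable_subtype_coe
  have hadd := measure_inter_add_sdiff (μ := rectMeasure Ω) S hEm
  have himg : Subtype.val '' (S ∩ Subtype.val ⁻¹' E.1) = Subtype.val '' S ∩ E.1 :=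
    image_inter_preimage _ _ _
  rw [germPreimage_proj_preimage, ← himg, ← rectMeasure_apply_of_subset E.2.subset
    E.2.rectifiable (hS.inter hEm) (himg ▸ inter_subset_right)] at hE
  have hfin' : rectMeasure Ω (S ∩ Subtype.val ⁻¹' E.1) ≠ ∞ :=
    measure_ne_top_of_subset inter_subset_left hfin
  rw [← hadd] at hE
  by_contra! hle
  refine absurd hE (not_lt.2 ?_)
  refine ENNReal.le_sub_of_add_le_right
    (ne_top_of_le_ne_top (measure_ne_top_of_subset sdiff_subset hfin) hle) ?_
  gcongr

/-- Every `ℐ̂`-nonnegligible set contains, up to a negligible set, the part of the fiber space over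
a Borel set of positive finite measure, within the range of a section. -/
theorem exists_measurableSet_proj_preimage_diff_null (hΩ : IsOpen Ω) {A : Set (FiberSpace Ω)}
    (hA : MeasurableSet A) (hA0 : fiberMeasure Ω A ≠ 0) :
    ∃ S : Set Ω, MeasurableSet S ∧ rectMeasure Ω S ≠ 0 ∧ rectMeasure Ω S ≠ ∞ ∧
      fiberMeasure Ω (proj ⁻¹' S \ A) = 0 := by
  rw [fiberMeasure_apply hΩ hA] at hA0
  obtain ⟨E, hE⟩ : ∃ E : Normalized Ω, μHE[n - 1] (germPreimage E A) ≠ 0 := by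
    by_contra! h
    exact hA0 (by simp [h])
  obtain ⟨B, hBG, hB, hae⟩ := (nullMeasurableSet_of_isCaratheodory (hA E)
    (germPreimage_ne_top E A)).exists_measurable_subset_ae_eq
  have hBE : B ⊆ E.1 := hBG.trans (germPreimage_subset E A)
  have hI := rectMeasure_preimage_inter E hB
  have hI' := rectMeasure_preimage_inter_ne_top E hB
  rw [inter_eq_right.2 hBE] at hI hI'
  have hS : MeasurableSet (Subtype.val ⁻¹' B : Set Ω) := hB.preimage measurable_subtype_coe
  refine ⟨Subtype.val ⁻¹' B, hS, ?_, hI', ?_⟩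
  · rwa [hI, measure_congr hae]
  · rw [fiberMeasure_apply_of_subset hΩ E ((measurable_proj hΩ hS).diff hA)
      (sdiff_subset.trans (preimage_mono (preimage_mono hBE)))]
    -- Over `B` the section of `E` takes values in `A`, so nothing remains.
    refine measure_mono_null (t := ∅) (fun x hx => ?_) measure_empty
    obtain ⟨hxE, h1, h2⟩ := mem_germPreimage.1 hx
    obtain ⟨_, h3⟩ := mem_germPreimage.1 (hBG h1)
    exact h2 h3

/-! ### The pairing induced by a measure preserving map, and its norm. -/

section Pairing

variable {X Y : Type*} [MeasurableSpace X] [MeasurableSpace Y] {μ : Measure X} {ν : Measure Y}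
  {p : X → Y}

/-- The pairing `(g, f) ↦ ∫ g (f ∘ p) dμ` induced by a measure preserving map `p`. -/
def pullbackPairing (hp : MeasurePreserving p μ ν) :
    Lp ℝ ∞ μ →L[ℝ] StrongDual ℝ (Lp ℝ 1 ν) :=
  (ContinuousLinearMap.compL ℝ (Lp ℝ 1 ν) (Lp ℝ 1 μ) ℝ).flip
    (Lp.compMeasurePreservingₗᵢ ℝ p hp).toContinuousLinearMap ∘L
    (ContinuousLinearMap.mul ℝ ℝ).lpPairing μ ∞ 1

theorem integrable_mul_comp (hp : MeasurePreserving p μ ν) {g : X → ℝ} (hg : MemLp g ∞ μ)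
    {f : Y → ℝ} (hf : MemLp f 1 ν) : Integrable (fun z => g z * f (p z)) μ :=
  memLp_one_iff_integrable.1 ((hf.comp_measurePreserving hp).mul hg)

theorem pullbackPairing_apply (hp : MeasurePreserving p μ ν) {g : X → ℝ} (hg : MemLp g ∞ μ)
    {f : Y → ℝ} (hf : MemLp f 1 ν) :
    pullbackPairing hp (hg.toLp g) (hf.toLp f) = ∫ z, g z * f (p z) ∂μ := by
  have h : pullbackPairing hp (hg.toLp g) (hf.toLp f) =
      (ContinuousLinearMap.mul ℝ ℝ).lpPairing μ ∞ 1 (hg.toLp g)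
        (Lp.compMeasurePreserving p hp (hf.toLp f)) := rfl
  rw [h, ContinuousLinearMap.lpPairing_eq_integral, Lp.toLp_compMeasurePreserving hf hp]
  refine integral_congr_ae ?_
  filter_upwards [hg.coeFn_toLp, (hf.comp_measurePreserving hp).coeFn_toLp] with z h1 h2
  rw [h1, h2]
  rfl

theorem norm_pullbackPairing_le (hp : MeasurePreserving p μ ν) (g : Lp ℝ ∞ μ) :
    ‖pullbackPairing hp g‖ ≤ ‖g‖ := by
  refine ContinuousLinearMap.opNorm_le_bound _ (norm_nonneg _) fun f => ?_
  have h : pullbackPairing hp g f = L1.integralCLM' ℝ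
      ((ContinuousLinearMap.mul ℝ ℝ).holder 1 g (Lp.compMeasurePreserving p hp f)) := rfl
  rw [h, ← L1.integral_eq']
  refine (L1.norm_integral_le _).trans ?_
  refine (ContinuousLinearMap.norm_holder_apply_apply_le _ _ _).trans ?_
  rw [Lp.norm_compMeasurePreserving]
  gcongr
  exact (mul_le_of_le_one_left (norm_nonneg _) (ContinuousLinearMap.opNorm_mul_le ℝ ℝ))

theorem pullbackPairing_indicator (hp : MeasurePreserving p μ ν) {g : X → ℝ} (hg : MemLp g ∞ μ)
    {S : Set Y} (hS : MeasurableSet S) (hfin : ν S ≠ ∞) :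
    pullbackPairing hp (hg.toLp g) (indicatorConstLp 1 hS hfin 1) = ∫ z in p ⁻¹' S, g z ∂μ := by
  rw [indicatorConstLp, pullbackPairing_apply, ← integral_indicator (hp.measurable hS)]
  congr 1
  funext z
  by_cases hz : p z ∈ S
  · rw [indicator_of_mem hz, indicator_of_mem (show z ∈ p ⁻¹' S from hz), mul_one]
  · rw [indicator_of_notMem hz, indicator_of_notMem (show z ∉ p ⁻¹' S from hz), mul_zero]

/-- The functional is tested on the indicator of a set `S` over which `g > c` almost everywhere.
Functions on `Y` only see preimages under `p`, so `hsec` is what makes such an `S` available. -/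
theorem le_norm_pullbackPairing (hp : MeasurePreserving p μ ν)
    (hsec : ∀ A, MeasurableSet A → μ A ≠ 0 → ∃ S, MeasurableSet S ∧ ν S ≠ 0 ∧ ν S ≠ ∞ ∧
      μ (p ⁻¹' S \ A) = 0) {g : X → ℝ} (hgm : Measurable g) (hg : MemLp g ∞ μ) {c : ℝ}
    (hc : μ {z | c < g z} ≠ 0) : c ≤ ‖pullbackPairing hp (hg.toLp g)‖ := by
  obtain ⟨S, hS, hS0, hSfin, hSA⟩ := hsec _ (measurableSet_lt measurable_const hgm) hc
  have hpos : 0 < ν.real S := ENNReal.toReal_pos hS0 hSfin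
  have hμS : μ (p ⁻¹' S) = ν S := hp.measure_preimage hS.nullMeasurableSet
  have hint : IntegrableOn g (p ⁻¹' S) μ := by
    have : IsFiniteMeasure (μ.restrict (p ⁻¹' S)) := ⟨by simpa [hμS] using hSfin.lt_top⟩
    exact (hg.mono_measure Measure.restrict_le_self).integrable le_top
  have h1 : c * ν.real S ≤ ∫ z in p ⁻¹' S, g z ∂μ := by
    have h2 : ∫ _ in p ⁻¹' S, c ∂μ ≤ ∫ z in p ⁻¹' S, g z ∂μ := by
      refine setIntegral_mono_on_ae (integrableOn_const (by rw [hμS]; exact hSfin)) hint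
        (hp.measurable hS) ?_
      filter_upwards [measure_eq_zero_iff_ae_notMem.1 hSA] with z hz hzS
      by_contra h
      exact hz ⟨hzS, fun h' => h (le_of_lt h')⟩
    rw [setIntegral_const, smul_eq_mul, mul_comm] at h2
    rwa [measureReal_def, hμS] at h2
  rw [← pullbackPairing_indicator hp hg hS hSfin] at h1
  have h3 := (le_abs_self _).trans ((pullbackPairing hp (hg.toLp g)).le_opNorm
    (indicatorConstLp 1 hS hSfin 1))
  rw [norm_indicatorConstLp one_ne_zero ENNReal.one_ne_top] at h3
  simp only [norm_one, one_mul, ENNReal.toReal_one, div_one, Real.rpow_one] at h3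
  exact le_of_mul_le_mul_right (h1.trans h3) hpos

theorem norm_pullbackPairing (hp : MeasurePreserving p μ ν)
    (hsec : ∀ A, MeasurableSet A → μ A ≠ 0 → ∃ S, MeasurableSet S ∧ ν S ≠ 0 ∧ ν S ≠ ∞ ∧
      μ (p ⁻¹' S \ A) = 0) (g : Lp ℝ ∞ μ) : ‖pullbackPairing hp g‖ = ‖g‖ := by
  refine le_antisymm (norm_pullbackPairing_le hp g) (le_of_forall_lt_imp_le_of_dense fun c hc => ?_)
  rcases lt_or_ge c 0 with hc0 | hc0
  · exact hc0.le.trans (norm_nonneg _)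
  have hgm : Measurable g := (Lp.stronglyMeasurable g).measurable
  by_cases h1 : μ {z | c < g z} = 0
  · by_cases h2 : μ {z | c < -g z} = 0
    · refine absurd hc (not_lt.2 ?_)
      rw [Lp.norm_def, eLpNorm_exponent_top]
      refine ENNReal.toReal_le_of_le_ofReal hc0 (eLpNormEssSup_le_of_ae_bound ?_)
      filter_upwards [measure_eq_zero_iff_ae_notMem.1 h1, measure_eq_zero_iff_ae_notMem.1 h2]
        with z hz1 hz2
      exact abs_le'.2 ⟨not_lt.1 hz1, not_lt.1 hz2⟩
    · have := le_norm_pullbackPairing hp hsec hgm.neg (Lp.memLp g).neg h2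
      rwa [MemLp.toLp_neg (Lp.memLp g), Lp.toLp_coeFn, map_neg, norm_neg] at this
  · have := le_norm_pullbackPairing hp hsec hgm (Lp.memLp g) h1
    rwa [Lp.toLp_coeFn] at this

end Pairing

/-! ### Functionals on `L¹` restricted to sets of finite measure. -/

section Representation

variable {Y : Type*} [MeasurableSpace Y] {ν : Measure Y}

theorem memLp_one_indicator_of_memLp_two {S : Set Y} (hS : MeasurableSet S) (hfin : ν S ≠ ∞)
    (f : Lp ℝ 2 (ν.restrict S)) : MemLp (S.indicator f) 1 ν := by
  have : IsFiniteMeasure (ν.restrict S) := ⟨by simpa using hfin.lt_top⟩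
  exact (memLp_indicator_iff_restrict hS).2 ((Lp.memLp f).mono_exponent one_le_two)

theorem indicator_ae_eq_of_restrict {S : Set Y} (hS : MeasurableSet S) {f g : Y → ℝ}
    (h : f =ᵐ[ν.restrict S] g) : S.indicator f =ᵐ[ν] S.indicator g := by
  filter_upwards [(ae_restrict_iff' hS).1 h] with y hy
  by_cases hyS : y ∈ S
  · rw [indicator_of_mem hyS, indicator_of_mem hyS, hy hyS]
  · rw [indicator_of_notMem hyS, indicator_of_notMem hyS]

/-- Extension by zero from `L²` of a set of finite measure to `L¹`. -/
def extendByZero {S : Set Y} (hS : MeasurableSet S) (hfin : ν S ≠ ∞) :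
    Lp ℝ 2 (ν.restrict S) →L[ℝ] Lp ℝ 1 ν :=
  LinearMap.mkContinuous
    { toFun := fun f => (memLp_one_indicator_of_memLp_two hS hfin f).toLp
      map_add' := fun f g => by
        rw [← MemLp.toLp_add]
        refine MemLp.toLp_congr _ _ ?_
        rw [← indicator_add']
        exact indicator_ae_eq_of_restrict hS (Lp.coeFn_add f g)
      map_smul' := fun c f => by
        rw [RingHom.id_apply, ← MemLp.toLp_const_smul]
        refine MemLp.toLp_congr _ _ ?_
        rw [show c • S.indicator f = S.indicator (c • ⇑f) from
          (indicator_const_smul S c f).symm]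
        exact indicator_ae_eq_of_restrict hS (Lp.coeFn_smul c f) }
    -- The Hölder constant `ν(S) ^ (1/2)`.
    ((ν S ^ (1 / (1 : ℝ≥0∞).toReal - 1 / (2 : ℝ≥0∞).toReal)).toReal) fun f => by
      have hC : ν S ^ (1 / (1 : ℝ≥0∞).toReal - 1 / (2 : ℝ≥0∞).toReal) ≠ ∞ :=
        ENNReal.rpow_ne_top_of_nonneg (by norm_num) hfin
      simp only [LinearMap.coe_mk, AddHom.coe_mk, Lp.norm_toLp]
      rw [eLpNorm_indicator_eq_eLpNorm_restrict hS, Lp.norm_def, ← ENNReal.toReal_mul, mul_comm]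
      refine ENNReal.toReal_mono (ENNReal.mul_ne_top (Lp.memLp f).2.ne hC) ?_
      have := eLpNorm_le_eLpNorm_mul_rpow_measure_univ (one_le_two (α := ℝ≥0∞))
        (Lp.memLp f).1
      rwa [Measure.restrict_apply_univ] at this

theorem extendByZero_apply {S : Set Y} (hS : MeasurableSet S) (hfin : ν S ≠ ∞)
    (f : Lp ℝ 2 (ν.restrict S)) :
    extendByZero hS hfin f = (memLp_one_indicator_of_memLp_two hS hfin f).toLp := rfl

/-- A continuous linear functional on `L¹` is represented, on a set of finite measure, by an
integrable function. -/
theorem exists_measurable_forall_eq_setIntegral (Λ : StrongDual ℝ (Lp ℝ 1 ν)) {S : Set Y}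
    (hS : MeasurableSet S) (hfin : ν S ≠ ∞) :
    ∃ h : Y → ℝ, Measurable h ∧ IntegrableOn h S ν ∧ ∀ (B : Set Y) (hB : MeasurableSet B)
      (hBfin : ν B ≠ ∞), B ⊆ S → Λ (indicatorConstLp 1 hB hBfin 1) = ∫ y in B, h y ∂ν := by
  have : IsFiniteMeasure (ν.restrict S) := ⟨by simpa using hfin.lt_top⟩
  -- On a set of finite measure `L²` maps continuously to `L¹`, so the Riesz representation theorem
  -- in `L²` provides the density.
  set h := (InnerProductSpace.toDual ℝ (Lp ℝ 2 (ν.restrict S))).symm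
    (Λ ∘L extendByZero hS hfin) with hh
  refine ⟨h, (Lp.stronglyMeasurable h).measurable, (Lp.memLp h).integrable one_le_two,
    fun B hB hBfin hBS => ?_⟩
  have hB' : (ν.restrict S) B ≠ ∞ := measure_ne_top _ _
  have h1 : inner ℝ h (indicatorConstLp 2 hB hB' (1 : ℝ)) =
      Λ (extendByZero hS hfin (indicatorConstLp 2 hB hB' (1 : ℝ))) := by
    rw [hh, InnerProductSpace.toDual_symm_apply]
    rfl
  rw [real_inner_comm, L2.inner_indicatorConstLp_one, Measure.restrict_restrict hB,
    inter_eq_left.2 hBS] at h1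
  rw [h1, extendByZero_apply, indicatorConstLp]
  congr 1
  refine MemLp.toLp_congr _ _ ?_
  have h2 := indicator_ae_eq_of_restrict hS
    (indicatorConstLp_coeFn (p := 2) (hs := hB) (hμs := hB') (c := (1 : ℝ)))
  refine EventuallyEq.trans ?_ h2.symm
  rw [indicator_indicator, inter_eq_right.2 hBS]

/-- The value of a functional on the indicator function of a set, as a function of the set. -/
def setValue (Λ : StrongDual ℝ (Lp ℝ 1 ν)) (S : Set Y) : ℝ :=
  open Classical in
  if h : MeasurableSet S ∧ ν S ≠ ∞ then Λ (indicatorConstLp 1 h.1 h.2 1) else 0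

theorem setValue_eq (Λ : StrongDual ℝ (Lp ℝ 1 ν)) {S : Set Y} (hS : MeasurableSet S)
    (hfin : ν S ≠ ∞) : setValue Λ S = Λ (indicatorConstLp 1 hS hfin 1) := dif_pos ⟨hS, hfin⟩

theorem norm_indicatorConstLp_one_real {S : Set Y} (hS : MeasurableSet S) (hfin : ν S ≠ ∞) :
    ‖indicatorConstLp 1 hS hfin (1 : ℝ)‖ = ν.real S := by
  rw [norm_indicatorConstLp one_ne_zero ENNReal.one_ne_top]
  simp

theorem abs_setValue_le (Λ : StrongDual ℝ (Lp ℝ 1 ν)) {S : Set Y} (hS : MeasurableSet S)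
    (hfin : ν S ≠ ∞) : |setValue Λ S| ≤ ‖Λ‖ * ν.real S := by
  rw [setValue_eq Λ hS hfin, ← norm_indicatorConstLp_one_real hS hfin]
  exact Λ.le_opNorm _

theorem setValue_inter_add_sdiff (Λ : StrongDual ℝ (Lp ℝ 1 ν)) {S T : Set Y}
    (hS : MeasurableSet S) (hSfin : ν S ≠ ∞) (hT : MeasurableSet T) :
    setValue Λ (S ∩ T) + setValue Λ (S \ T) = setValue Λ S := by
  have h1 := measure_ne_top_of_subset (inter_subset_left (t := T)) hSfin
  have h2 := measure_ne_top_of_subset (sdiff_subset (t := T)) hSfin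
  rw [setValue_eq Λ (hS.inter hT) h1, setValue_eq Λ (hS.diff hT) h2, setValue_eq Λ hS hSfin,
    ← map_add, ← indicatorConstLp_disjoint_union (hS.inter hT) (hS.diff hT) h1 h2
      (disjoint_sdiff_inter.symm)]
  simp only [inter_union_sdiff]

end Representation

/-! ### Differentiation of a functional along germs. -/

/-- The number `L` is the derivative at `x` of the set function induced by a functional `Λ` on
`L¹`, along `E` and relative to the `(n-1)`-dimensional volume of balls. -/
def HasGermLimit (Λ : StrongDual ℝ (Lp ℝ 1 (rectMeasure Ω))) (E : Set (EuclideanSpace ℝ (Fin n)))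
    (x : EuclideanSpace ℝ (Fin n)) (L : ℝ) : Prop :=
  Tendsto (fun r => setValue Λ (Subtype.val ⁻¹' (E ∩ closedBall x r)) /
    (volume (closedBall (0 : EuclideanSpace ℝ (Fin (n - 1))) 1) *
      ENNReal.ofReal r ^ (n - 1)).toReal) (𝓝[>] 0) (𝓝 L)

theorem abs_setValue_div_le (Λ : StrongDual ℝ (Lp ℝ 1 (rectMeasure Ω))) (E : Normalized Ω)
    {C : Set (EuclideanSpace ℝ (Fin n))} (hC : MeasurableSet C) (hCE : C ⊆ E.1)
    (x : EuclideanSpace ℝ (Fin n)) (r : ℝ) :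
    |setValue Λ (Subtype.val ⁻¹' (C ∩ closedBall x r)) /
      (volume (closedBall (0 : EuclideanSpace ℝ (Fin (n - 1))) 1) *
        ENNReal.ofReal r ^ (n - 1)).toReal| ≤ ‖Λ‖ * (densityRatio C x r).toReal := by
  have hm : MeasurableSet (C ∩ closedBall x r) := hC.inter isClosed_closedBall.measurableSet
  have h1 := rectMeasure_preimage_inter E hm
  have h2 := rectMeasure_preimage_inter_ne_top E hm
  rw [inter_eq_right.2 (inter_subset_left.trans hCE)] at h1 h2
  have h3 := abs_setValue_le Λ (hm.preimage measurable_subtype_coe) h2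
  rw [measureReal_def, h1] at h3
  rw [abs_div, abs_of_nonneg ENNReal.toReal_nonneg, densityRatio, ENNReal.toReal_div,
    ← mul_div_assoc]
  gcongr
  exact h3

/-- `E \ F` and `F \ E` have density zero at `x`, and on subsets of a member of `ℰ` the functional
is at most `‖Λ‖` times the Hausdorff measure; their contribution vanishes in the limit. -/
theorem HasGermLimit.congr {Λ : StrongDual ℝ (Lp ℝ 1 (rectMeasure Ω))} {E F : Normalized Ω}
    {x : EuclideanSpace ℝ (Fin n)} (hEF : HasDensity (E.1 ∆ F.1) x 0) {L : ℝ}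
    (h : HasGermLimit Λ E.1 x L) : HasGermLimit Λ F.1 x L := by
  have hEm := E.2.measurableSet
  have hFm := F.2.measurableSet
  have split : ∀ (G G' : Normalized Ω) (r : ℝ),
      setValue Λ (Subtype.val ⁻¹' (G.1 ∩ closedBall x r)) =
        setValue Λ (Subtype.val ⁻¹' (G.1 ∩ G'.1 ∩ closedBall x r)) +
          setValue Λ (Subtype.val ⁻¹' ((G.1 \ G'.1) ∩ closedBall x r)) := by
    intro G G' r
    have hb : MeasurableSet (closedBall x r) := isClosed_closedBall.measurableSet
    rw [← setValue_inter_add_sdiff Λ ((G.2.measurableSet.inter hb).preimage measurable_subtype_coe)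
      (rectMeasure_preimage_inter_ne_top G hb) (G'.2.measurableSet.preimage measurable_subtype_coe)]
    congr 2
    · ext y; simp only [mem_inter_iff, mem_preimage]; tauto
    · ext y; simp only [mem_inter_iff, mem_preimage, Set.mem_sdiff]; tauto
  have hz : ∀ (G G' : Normalized Ω), HasDensity (G.1 ∆ G'.1) x 0 →
      HasGermLimit Λ (G.1 \ G'.1) x 0 := by
    intro G G' hd
    have hlim : Tendsto (fun r => ‖Λ‖ * (densityRatio (G.1 \ G'.1) x r).toReal) (𝓝[>] 0)
        (𝓝 0) := by
      have h0 : HasDensity (G.1 \ G'.1) x 0 :=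
        hd.zero_of_subset_union hd (fun y hy => Or.inl (Or.inl hy))
      have := ((ENNReal.tendsto_toReal ENNReal.zero_ne_top).comp h0).const_mul ‖Λ‖
      simpa using this
    refine squeeze_zero_norm (fun r => ?_) hlim
    exact abs_setValue_div_le Λ G (G.2.measurableSet.diff G'.2.measurableSet) sdiff_subset x r
  have h1 := (h.sub (hz E F hEF)).add (hz F E (by rwa [symmDiff_comm]))
  rw [sub_zero, add_zero] at h1
  refine h1.congr fun r => ?_
  rw [split E F, split F E, inter_comm F.1 E.1]
  ring

/-- The function on the fiber space that represents the functional `Λ`. -/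
def germDerivative (Λ : StrongDual ℝ (Lp ℝ 1 (rectMeasure Ω))) (z : FiberSpace Ω) : ℝ :=
  open Classical in
  -- The choice of representative is harmless by `HasGermLimit.congr`; the default `0` keeps the
  -- bound by `‖Λ‖` valid at every germ.
  if h : ∃ L, HasGermLimit Λ z.2.out.1 z.1.1 L then h.choose else 0

theorem germDerivative_germMap {Λ : StrongDual ℝ (Lp ℝ 1 (rectMeasure Ω))} {E : Normalized Ω}
    {x : EuclideanSpace ℝ (Fin n)} (hx : x ∈ E.1) {L : ℝ} (h : HasGermLimit Λ E.1 x L) :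
    germDerivative Λ (germMap E ⟨x, hx⟩) = L := by
  have hd : HasDensity ((germMap E ⟨x, hx⟩).2.out.1 ∆ E.1) x 0 :=
    Quotient.mk_out (s := germSetoid Ω x) (⟨E.1, E.2, hx⟩ : NormalizedAt Ω x)
  have hout : HasGermLimit Λ (germMap E ⟨x, hx⟩).2.out.1 x L :=
    h.congr (F := ⟨_, (germMap E ⟨x, hx⟩).2.out.2.1⟩) (by rwa [symmDiff_comm])
  have hex : ∃ L, HasGermLimit Λ (germMap E ⟨x, hx⟩).2.out.1 x L := ⟨L, hout⟩
  have : germDerivative Λ (germMap E ⟨x, hx⟩) = hex.choose := dif_pos hex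
  rw [this]
  exact tendsto_nhds_unique hex.choose_spec hout

theorem abs_germDerivative_le (Λ : StrongDual ℝ (Lp ℝ 1 (rectMeasure Ω))) (z : FiberSpace Ω) :
    |germDerivative Λ z| ≤ ‖Λ‖ := by
  rw [germDerivative]
  split_ifs with h
  · let E : Normalized Ω := ⟨z.2.out.1, z.2.out.2.1⟩
    have hlim : Tendsto (fun r => ‖Λ‖ * (densityRatio E.1 z.1.1 r).toReal) (𝓝[>] 0) (𝓝 ‖Λ‖) := by
      have h1 : HasDensity E.1 z.1.1 1 := E.hasDensity z.2.out.2.2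
      have := ((ENNReal.tendsto_toReal ENNReal.one_ne_top).comp h1).const_mul ‖Λ‖
      simpa using this
    exact le_of_tendsto_of_tendsto h.choose_spec.abs hlim (Eventually.of_forall fun r =>
      abs_setValue_div_le Λ E E.2.measurableSet subset_rfl _ r)
  · simp

/-- The density of the set function induced by `Λ` on a member of `ℰ`. -/
theorem exists_density (hΩ : IsOpen Ω) (Λ : StrongDual ℝ (Lp ℝ 1 (rectMeasure Ω)))
    (E : Normalized Ω) :
    ∃ h : EuclideanSpace ℝ (Fin n) → ℝ, Measurable h ∧
      (∀ S : Set Ω, MeasurableSet S → S ⊆ Subtype.val ⁻¹' E.1 →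
        setValue Λ S = ∫ y in S, h y ∂(rectMeasure Ω)) ∧
      ∀ᵐ x ∂(μHE[n - 1] : Measure (EuclideanSpace ℝ (Fin n))), x ∈ E.1 →
        HasGermLimit Λ E.1 x (h x) := by
  have hEm : MeasurableSet (Subtype.val ⁻¹' E.1 : Set Ω) :=
    E.2.measurableSet.preimage measurable_subtype_coe
  have hEfin : rectMeasure Ω (Subtype.val ⁻¹' E.1) ≠ ∞ := by
    simpa using rectMeasure_preimage_inter_ne_top E MeasurableSet.univ
  have hemb : MeasurableEmbedding (Subtype.val : Ω → EuclideanSpace ℝ (Fin n)) :=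
    MeasurableEmbedding.subtype_coe hΩ.measurableSet
  obtain ⟨h₀, hm₀, hint₀, hrep₀⟩ := exists_measurable_forall_eq_setIntegral Λ hEm hEfin
  obtain ⟨h, hm, hh⟩ := hemb.exists_measurable_extend hm₀ fun _ => ⟨0⟩
  have hrep : ∀ S : Set Ω, MeasurableSet S → S ⊆ Subtype.val ⁻¹' E.1 →
      setValue Λ S = ∫ y in S, h y ∂(rectMeasure Ω) := by
    intro S hS hSE
    have hSfin := measure_ne_top_of_subset hSE hEfin
    rw [setValue_eq Λ hS hSfin, hrep₀ S hS hSfin hSE, ← hh]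
    rfl
  set μE := (μHE[n - 1] : Measure (EuclideanSpace ℝ (Fin n))).restrict E.1 with hμE
  have hfin : IsFiniteMeasure μE := ⟨by simpa [hμE] using E.measure_ne_top.lt_top⟩
  have hmap : ((rectMeasure Ω).restrict (Subtype.val ⁻¹' E.1)).map Subtype.val = μE :=
    map_val_restrict_rectMeasure E
  have hint : Integrable h μE := by
    rw [← hmap, hemb.integrable_map_iff, hh]
    exact hint₀
  refine ⟨h, hm, hrep, ?_⟩
  have hball : ∀ x r, setValue Λ (Subtype.val ⁻¹' (E.1 ∩ closedBall x r)) =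
      ∫ y in closedBall x r, h y ∂μE := by
    intro x r
    have hb : MeasurableSet (closedBall x r) := isClosed_closedBall.measurableSet
    rw [hrep _ ((E.2.measurableSet.inter hb).preimage measurable_subtype_coe)
      (preimage_mono inter_subset_left), ← hmap, hemb.setIntegral_map,
      Measure.restrict_restrict (hb.preimage measurable_subtype_coe), ← preimage_inter,
      inter_comm]
  -- Besicovitch differentiation gives convergence of the averages over `μE`-balls. Multiplying by
  -- the density ratio, which tends to `1` at points of `E`, replaces the normalization `μE(B(x,r))`
  -- by `α(n-1) r^{n-1}`.
  have hae := (Besicovitch.vitaliFamily μE).ae_tendsto_average hint.locallyIntegrable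
  filter_upwards [(ae_restrict_iff' E.2.measurableSet).1 hae] with x hx hxE
  have h1 := (hx hxE).comp (Besicovitch.tendsto_filterAt μE x)
  have h2 := (ENNReal.tendsto_toReal ENNReal.one_ne_top).comp (E.hasDensity hxE)
  have h3 := h1.mul h2
  rw [ENNReal.toReal_one, mul_one] at h3
  refine h3.congr fun r => ?_
  have h4 : hausdorffOuter n (E.1 ∩ closedBall x r) = μE (closedBall x r) := by
    rw [hμE, Measure.restrict_apply isClosed_closedBall.measurableSet, inter_comm]
    rfl
  simp only [Function.comp]
  rw [hball, ← measure_smul_setAverage h (measure_ne_top μE (closedBall x r)), smul_eq_mul,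
    densityRatio, ENNReal.toReal_div, h4, measureReal_def]
  ring

/-- Along each section `γ_E` the function agrees almost everywhere with a Borel density, which is
all that the σ-algebra of `Ω̂` requires. -/
theorem measurable_germDerivative (hΩ : IsOpen Ω) (Λ : StrongDual ℝ (Lp ℝ 1 (rectMeasure Ω))) :
    Measurable (germDerivative Λ) := by
  intro U hU E
  obtain ⟨h, hm, -, hae⟩ := exists_density hΩ Λ E
  refine isCaratheodory_of_nullMeasurableSet ?_
  refine ((E.2.measurableSet.inter (hm hU)).nullMeasurableSet).congr ?_
  refine eventuallyEq_set.2 ?_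
  filter_upwards [hae] with x hx
  rw [mem_germPreimage]
  refine ⟨fun ⟨hE, hxU⟩ => ⟨hE, ?_⟩, fun ⟨hE, hxU⟩ => ⟨hE, ?_⟩⟩
  · rw [mem_preimage, germDerivative_germMap hE (hx hE)]
    exact hxU
  · rwa [mem_preimage, germDerivative_germMap hE (hx hE)] at hxU

theorem memLp_germDerivative (hΩ : IsOpen Ω) (Λ : StrongDual ℝ (Lp ℝ 1 (rectMeasure Ω))) :
    MemLp (germDerivative Λ) ∞ (fiberMeasure Ω) :=
  memLp_top_of_bound (measurable_germDerivative hΩ Λ).aestronglyMeasurable ‖Λ‖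
    (Eventually.of_forall (abs_germDerivative_le Λ))

/-- The set where `germDerivative Λ` differs from the density over `S` lies over `E`, so its measure
is computed by the section of `E` alone, where it is null. -/
theorem setIntegral_germDerivative (hΩ : IsOpen Ω) (Λ : StrongDual ℝ (Lp ℝ 1 (rectMeasure Ω)))
    (E : Normalized Ω) {S : Set Ω} (hS : MeasurableSet S) (hSE : S ⊆ Subtype.val ⁻¹' E.1) :
    ∫ z in proj ⁻¹' S, germDerivative Λ z ∂(fiberMeasure Ω) = setValue Λ S := by
  obtain ⟨h, hm, hrep, hae⟩ := exists_density hΩ Λ E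
  have hp := measurePreserving_proj hΩ
  have hhm : Measurable fun y : Ω => h y := hm.comp measurable_subtype_coe
  rw [hrep S hS hSE, ← hp.map_eq, setIntegral_map hS hhm.aestronglyMeasurable
    hp.measurable.aemeasurable]
  refine setIntegral_congr_ae (hp.measurable hS) ?_
  set N : Set (FiberSpace Ω) := proj ⁻¹' S ∩ {z | germDerivative Λ z = h (proj z)}ᶜ with hN
  have hNm : MeasurableSet N := (hp.measurable hS).inter
    (measurableSet_eq_fun (measurable_germDerivative hΩ Λ) (hhm.comp hp.measurable)).compl
  have hN0 : fiberMeasure Ω N = 0 := by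
    rw [fiberMeasure_apply_of_subset hΩ E hNm (inter_subset_left.trans (preimage_mono hSE))]
    refine measure_mono_null ?_ (ae_iff.1 hae)
    intro x hx hx'
    obtain ⟨hE, hxN⟩ := mem_germPreimage.1 hx
    exact hxN.2 (germDerivative_germMap hE (hx' hE))
  filter_upwards [measure_eq_zero_iff_ae_notMem.1 hN0] with z hz hzS
  by_contra hne
  exact hz ⟨hzS, hne⟩

/-! ### Surjectivity and the resulting isometry. -/

/-- The difference `Φ` vanishes on indicators of sets inside a member of `ℰ`. Such sets exhaust any
set of finite measure up to `ε`, so by continuity `Φ` vanishes on all indicators, hence on `L¹` by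
density of simple functions. -/
theorem pullbackPairing_germDerivative (hΩ : IsOpen Ω)
    (Λ : StrongDual ℝ (Lp ℝ 1 (rectMeasure Ω))) :
    pullbackPairing (measurePreserving_proj hΩ) ((memLp_germDerivative hΩ Λ).toLp) = Λ := by
  set Φ := pullbackPairing (measurePreserving_proj hΩ) ((memLp_germDerivative hΩ Λ).toLp) - Λ
    with hΦ
  have hsub : ∀ (E : Normalized Ω) {S : Set Ω} (hS : MeasurableSet S) (hfin : rectMeasure Ω S ≠ ∞),
      S ⊆ Subtype.val ⁻¹' E.1 → setValue Φ S = 0 := by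
    intro E S hS hfin hSE
    rw [setValue_eq Φ hS hfin, hΦ, sub_apply,
      pullbackPairing_indicator _ _ hS hfin, setIntegral_germDerivative hΩ Λ E hS hSE,
      setValue_eq Λ hS hfin, sub_self]
  have hind : ∀ {S : Set Ω} (hS : MeasurableSet S) (hfin : rectMeasure Ω S ≠ ∞),
      setValue Φ S = 0 := by
    intro S hS hfin
    have hle : ∀ ε : ℝ, 0 < ε → |setValue Φ S| ≤ ‖Φ‖ * ε := by
      intro ε hε
      obtain ⟨E, hE⟩ := exists_normalized_rectMeasure_diff_lt hΩ hS hfin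
        (ENNReal.ofReal_pos.2 hε).ne'
      have hEm : MeasurableSet (Subtype.val ⁻¹' E.1 : Set Ω) :=
        E.2.measurableSet.preimage measurable_subtype_coe
      rw [← setValue_inter_add_sdiff Φ hS hfin hEm, hsub E (hS.inter hEm)
        (measure_ne_top_of_subset inter_subset_left hfin) inter_subset_right, zero_add]
      refine (abs_setValue_le Φ (hS.diff hEm)
        (measure_ne_top_of_subset sdiff_subset hfin)).trans ?_
      gcongr
      exact ENNReal.toReal_le_of_le_ofReal hε.le hE.le
    have hlim : Tendsto (fun ε : ℝ => ‖Φ‖ * ε) (𝓝[>] 0) (𝓝 0) := by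
      have : Tendsto (fun ε : ℝ => ‖Φ‖ * ε) (𝓝 0) (𝓝 (‖Φ‖ * 0)) := tendsto_id.const_mul _
      rw [mul_zero] at this
      exact this.mono_left nhdsWithin_le_nhds
    refine abs_nonpos_iff.1 (ge_of_tendsto hlim ?_)
    filter_upwards [self_mem_nhdsWithin] with ε hε using hle ε hε
  have hzero : ∀ f, Φ f = 0 := by
    refine Lp.induction ENNReal.one_ne_top (fun f => Φ f = 0) ?_ ?_ ?_
    · intro c S hS hSfin
      rw [Lp.simpleFunc.coe_indicatorConst]
      have : indicatorConstLp 1 hS hSfin.ne c =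
          c • indicatorConstLp 1 hS hSfin.ne (1 : ℝ) := by
        simp only [indicatorConstLp]
        rw [← MemLp.toLp_const_smul]
        congr 1
        funext y
        by_cases hy : y ∈ S <;> simp [hy]
      rw [this, map_smul, ← setValue_eq Φ hS hSfin.ne, hind hS hSfin.ne, smul_zero]
    · intro f g hf hg _ h1 h2
      rw [map_add, h1, h2, add_zero]
    · exact isClosed_eq Φ.continuous continuous_const
  exact sub_eq_zero.1 (ContinuousLinearMap.ext hzero)

/-- The isometric isomorphism between `L^∞` of the fiber space and the dual of `L¹`. -/
def dualIsometry (hΩ : IsOpen Ω) :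
    Lp ℝ ∞ (fiberMeasure Ω) ≃ₗᵢ[ℝ] StrongDual ℝ (Lp ℝ 1 (rectMeasure Ω)) :=
  LinearIsometryEquiv.ofSurjective
    ⟨(pullbackPairing (measurePreserving_proj hΩ)).toLinearMap,
      norm_pullbackPairing (measurePreserving_proj hΩ) fun _ hA hA0 =>
        exists_measurableSet_proj_preimage_diff_null hΩ hA hA0⟩
    fun Λ => ⟨_, pullbackPairing_germDerivative hΩ Λ⟩

end RectGerm

end

theorem theorem2p5 (n : ℕ) (hn : 2 ≤ n) (Ω : Set (EuclideanSpace ℝ (Fin n))) (hΩ : IsOpen Ω) :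
    ∃ Υ : Lp ℝ ∞ (RectGerm.fiberMeasure Ω) ≃ₗᵢ[ℝ]
        StrongDual ℝ (Lp ℝ 1 (RectGerm.rectMeasure Ω)),
      ∀ (g : RectGerm.FiberSpace Ω → ℝ) (hg : MemLp g ∞ (RectGerm.fiberMeasure Ω))
        (f : Ω → ℝ) (hf : MemLp f 1 (RectGerm.rectMeasure Ω)),
        Integrable (fun z => g z * f (RectGerm.proj z)) (RectGerm.fiberMeasure Ω) ∧
          Υ (hg.toLp g) (hf.toLp f) =
            ∫ z, g z * f (RectGerm.proj z) ∂(RectGerm.fiberMeasure Ω) :=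
  ⟨RectGerm.dualIsometry hΩ, fun _ hg _ hf =>
    ⟨RectGerm.integrable_mul_comp (RectGerm.measurePreserving_proj hΩ) hg hf,
      RectGerm.pullbackPairing_apply (RectGerm.measurePreserving_proj hΩ) hg hf⟩⟩
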